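/- Let $K$ be a (non-Archimedean) local field, i.e. a non-discrete locally compact field with an ultrametric absolute value, and let $K^d$ carry the maximum norm and the Haar measure $\lambda$ normalised so that the closed unit ball has measure $1$. Let $X\subseteq K^d$ be an open subset, let $m=\lambda|_X$, and suppose $m(X)=\infty$ (so that $X$ is non-compact). Let $1\le t\le\infty$. A homeomorphism $\psi$ of $X$ belongs to $\mathrm{Diff}^t(X)$ if $\psi$ and $\psi^{-1}$ are of class $C^t$ in the non-Archimedean sense, where, for a map $f$ on an open set $U$ of a normed space over $K$: - for $0\le b<1$, $f$ is of class $C^b$ if $f(x)-f(y)=o(\|x-y\|^b)$ as $x,y\to a$, for each $a\in U$ (for $b=0$ this is continuity); - for an integer $k\ge 0$, $f$ is of class $C^{k+1+b}$ if the difference quotient $(f(x+\tau v)-f(x))/\tau$, $\tau\neq 0$, extends to a map of class $C^{k+b}$ on $\{(x,v,\tau): x\in U,\ x+\tau v\in U\}$; - $C^\infty=\bigcap_k C^k$. Let $\mathrm{Diff}^t(X,m)$ consist of the $\psi\in\mathrm{Diff}^t(X)$ that preserve $m$, i.e. $m(\psi^{-1}(E))=m(E)$ for all Borel sets $E\subseteq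 X$. Let $n\ge 1$, let $B^n_X$ be the space of $n$-point subsets of $X$, and let $m^n$ be the measure on $B^n_X$ that is the image of $m\otimes\dots\otimes m$ under $p_n:(x_1,\dots,x_n)\mapsto\{x_1,\dots,x_n\}$ (defined on tuples of distinct points). Let $s$ be any measurable cross-section of $p_n$. For a homeomorphism $\psi$ of $X$ and $\gamma\in B^n_X$, let $\sigma(\psi,\gamma)\in\Sigma_n$ be the permutation with $s(\psi^{-1}(\gamma))=\psi^{-1}(s(\gamma))\,\sigma(\psi,\gamma)$, where $(x_1,\dots,x_n)\sigma=(x_{\sigma(1)},\dots,x_{\sigma(n)})$. Let $q$ be an irreducible unitary representation of the symmetric group $\Sigma_n$ in a complex Hilbert space $W$. For the homeomorphisms $\psi$ of $X$ for which $m^n$ is quasi-invariant, let $$(V^q_m(\psi)f)(\gamma)=\rho(\psi,\gamma)^{1/2}\,q(\sigma(\psi,\gamma))\,f(\psi^{-1}(\gamma)),\qquad \rho(\psi,\gamma)=\frac{m^n(\psi^{-1}(d\gamma))}{m^n(d\gamma)},$$ which is a unitary representation in $L^2(B^n_X,m^n,W)$. Then the restriction of $V^q_m$ to $\mathrm{Diff}^t(X,m)$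 is irreducible: the space $L^2(B^n_X,m^n,W)$ is non-zero, and its only closed subspaces invariant under all $V^q_m(\psi)$, $\psi\in\mathrm{Diff}^t(X,m)$, are $0$ and the whole space. -/

import Mathlib

open MeasureTheory Filter Topology
open scoped ENNReal NNReal

universe u v w

set_option linter.unusedSectionVars false

noncomputable section

/-! ### Irreducibility of a family of unitary operators -/

/-- A family `T` of unitary operators on a complex Hilbert space `H` is irreducible if `H ≠ 0` and
the only closed subspaces of `H` invariant under all the operators in `T` are `0` and `H`. -/
def IsIrreducibleFamily {H : Type v} [NormedAddCommGroup H] [InnerProductSpace ℂ H]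
    (T : Set (H ≃ₗᵢ[ℂ] H)) : Prop :=
  Nontrivial H ∧ ∀ M : Submodule ℂ H, IsClosed (M : Set H) →
    (∀ A ∈ T, ∀ v ∈ M, A v ∈ M) → M = ⊥ ∨ M = ⊤

/-! ### Spaces of `n`-point subsets and their measures -/

/-- `n`-tuples of pairwise distinct points of `X`. -/
abbrev DistinctTuple (X : Type v) (n : ℕ) : Type v := {x : Fin n → X // Function.Injective x}

section Conf

variable {X : Type v} {n : ℕ}

/-- The map `(x₁, …, xₙ) ↦ {x₁, …, xₙ}` from tuples of distinct points to `n`-point subsets. -/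
def toSubset (x : DistinctTuple X n) : Set.powersetCard X n :=
  ⟨Finset.univ.map ⟨x.1, x.2⟩, by simp⟩

theorem mem_toSubset {x : DistinctTuple X n} {a : X} :
    a ∈ (toSubset x : Finset X) ↔ ∃ i, x.1 i = a := by
  simp [toSubset]

/-- The space of `n`-point subsets carries the quotient `σ`-algebra of the Borel `σ`-algebra on
tuples of distinct points (a set of `n`-point subsets is measurable iff the set of all
enumerations of its members is). -/
instance [MeasurableSpace X] : MeasurableSpace (Set.powersetCard X n) :=
  MeasurableSpace.map toSubset inferInstance

theorem measurable_toSubset [MeasurableSpace X] :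
    Measurable (toSubset : DistinctTuple X n → Set.powersetCard X n) :=
  fun _ h => h

/-- The image on the space of `n`-point subsets of the `n`-fold product measure `m ⊗ ⋯ ⊗ m`
(restricted to the tuples of distinct points). -/
def confMeasure [MeasurableSpace X] (m : Measure X) (n : ℕ) : Measure (Set.powersetCard X n) :=
  ((Measure.pi fun _ : Fin n => m).comap (Subtype.val : DistinctTuple X n → Fin n → X)).map toSubset

/-- A measurable cross-section of `(x₁, …, xₙ) ↦ {x₁, …, xₙ}`, i.e. a measurable way of
enumerating the `n`-point subsets of `X`. -/
structure MeasurableSection (X : Type v) [MeasurableSpace X] (n : ℕ) where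
  /-- the enumeration -/
  toFun : Set.powersetCard X n → DistinctTuple X n
  measurable_toFun : Measurable toFun
  toSubset_toFun : ∀ γ, toSubset (toFun γ) = γ

variable [TopologicalSpace X]

/-- The action of a homeomorphism of `X` on `n`-point subsets, `γ ↦ ψ(γ)`. -/
def confMap (ψ : X ≃ₜ X) (γ : Set.powersetCard X n) : Set.powersetCard X n :=
  Set.powersetCard.map n ψ.toEquiv.toEmbedding γ

theorem mem_confMap {ψ : X ≃ₜ X} {γ : Set.powersetCard X n} {a : X} :
    a ∈ (confMap ψ γ : Finset X) ↔ ψ⁻¹ a ∈ (γ : Finset X) := by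
  simp only [confMap, Set.powersetCard.val_map, Finset.mem_map]
  constructor
  · rintro ⟨b, hb, rfl⟩; simpa using hb
  · intro h; exact ⟨ψ⁻¹ a, h, by simp⟩

theorem confMap_mul (φ ψ : X ≃ₜ X) (γ : Set.powersetCard X n) :
    confMap (φ * ψ) γ = confMap φ (confMap ψ γ) := by
  ext a; simp only [mem_confMap, mul_inv_rev]; rfl

theorem confMap_one (γ : Set.powersetCard X n) : confMap (1 : X ≃ₜ X) γ = γ := by
  ext a; simp only [mem_confMap, inv_one]; rfl

@[simp] theorem confMap_inv_confMap (ψ : X ≃ₜ X) (γ : Set.powersetCard X n) :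
    confMap ψ⁻¹ (confMap ψ γ) = γ := by
  rw [← confMap_mul, inv_mul_cancel, confMap_one]

@[simp] theorem confMap_confMap_inv (ψ : X ≃ₜ X) (γ : Set.powersetCard X n) :
    confMap ψ (confMap ψ⁻¹ γ) = γ := by
  rw [← confMap_mul, mul_inv_cancel, confMap_one]

/-- The diagonal action of a homeomorphism on tuples of distinct points. -/
def tupleMap (ψ : X ≃ₜ X) (x : DistinctTuple X n) : DistinctTuple X n :=
  ⟨fun i => ψ (x.1 i), ψ.injective.comp x.2⟩

theorem confMap_toSubset (ψ : X ≃ₜ X) (x : DistinctTuple X n) :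
    confMap ψ (toSubset x) = toSubset (tupleMap ψ x) := by
  ext a
  simp only [mem_confMap, mem_toSubset, tupleMap]
  refine exists_congr fun i => ⟨fun h => by simp [h], fun h => by simp [← h]⟩

variable [MeasurableSpace X] [BorelSpace X]

theorem measurable_tupleMap (ψ : X ≃ₜ X) :
    Measurable (tupleMap ψ : DistinctTuple X n → DistinctTuple X n) := by
  refine Measurable.subtype_mk (measurable_pi_lambda _ fun i => ?_)
  exact ψ.measurable.comp ((measurable_pi_apply i).comp measurable_subtype_coe)

theorem measurable_confMap (ψ : X ≃ₜ X) :
    Measurable (confMap ψ : Set.powersetCard X n → Set.powersetCard X n) := by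
  intro s hs
  have h : Measurable ((confMap ψ : Set.powersetCard X n → _) ∘ toSubset) := by
    have : (confMap ψ : Set.powersetCard X n → _) ∘ toSubset = toSubset ∘ tupleMap ψ := by
      ext1 x; exact confMap_toSubset ψ x
    rw [this]
    exact measurable_toSubset.comp (measurable_tupleMap ψ)
  exact h hs

/-- The action of a homeomorphism on `n`-point subsets, as a measurable isomorphism. -/
def confEquiv (n : ℕ) (ψ : X ≃ₜ X) : Set.powersetCard X n ≃ᵐ Set.powersetCard X n where
  toFun := confMap ψ
  invFun := confMap ψ⁻¹
  left_inv := confMap_inv_confMap ψ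
  right_inv := confMap_confMap_inv ψ
  measurable_toFun := measurable_confMap ψ
  measurable_invFun := measurable_confMap ψ⁻¹

/-! ### The permutation cocycle of a cross-section -/

variable (s : MeasurableSection X n)

theorem exists_sigma (ψ : X ≃ₜ X) (γ : Set.powersetCard X n) :
    ∃ τ : Equiv.Perm (Fin n), ∀ i,
      (s.toFun (confMap ψ⁻¹ γ)).1 i = ψ⁻¹ ((s.toFun γ).1 (τ i)) := by
  have h : ∀ i, ∃ j, (s.toFun γ).1 j = ψ ((s.toFun (confMap ψ⁻¹ γ)).1 i) := by
    intro i
    rw [← mem_toSubset, s.toSubset_toFun]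
    have : (s.toFun (confMap ψ⁻¹ γ)).1 i ∈ (toSubset (s.toFun (confMap ψ⁻¹ γ)) : Finset X) :=
      mem_toSubset.2 ⟨i, rfl⟩
    rw [s.toSubset_toFun] at this
    rw [mem_confMap, inv_inv] at this
    exact this
  choose j hj using h
  have hinj : Function.Injective j := by
    intro a b hab
    apply (s.toFun (confMap ψ⁻¹ γ)).2
    apply ψ.injective
    rw [← hj, ← hj, hab]
  refine ⟨Equiv.ofBijective j (Finite.injective_iff_bijective.1 hinj), fun i => ?_⟩
  simp [hj]

/-- The permutation `σ(ψ, γ)` determined by `s(ψ⁻¹(γ)) = ψ⁻¹(s(γ)) σ(ψ, γ)`, where permutations act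
on tuples from the right by `(x₁, …, xₙ) σ = (x_{σ(1)}, …, x_{σ(n)})`. -/
def sigma (ψ : X ≃ₜ X) (γ : Set.powersetCard X n) : Equiv.Perm (Fin n) :=
  (exists_sigma s ψ γ).choose

theorem sigma_spec (ψ : X ≃ₜ X) (γ : Set.powersetCard X n) (i : Fin n) :
    (s.toFun (confMap ψ⁻¹ γ)).1 i = ψ⁻¹ ((s.toFun γ).1 (sigma s ψ γ i)) :=
  (exists_sigma s ψ γ).choose_spec i

theorem sigma_eq {ψ : X ≃ₜ X} {γ : Set.powersetCard X n} {τ : Equiv.Perm (Fin n)}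
    (h : ∀ i, (s.toFun (confMap ψ⁻¹ γ)).1 i = ψ⁻¹ ((s.toFun γ).1 (τ i))) : sigma s ψ γ = τ := by
  ext1 i
  apply (s.toFun γ).2
  apply (ψ⁻¹).injective
  rw [← h, ← sigma_spec]

theorem sigma_one (γ : Set.powersetCard X n) : sigma s 1 γ = 1 :=
  sigma_eq s fun i => by simp [confMap_one]

theorem sigma_mul (φ ψ : X ≃ₜ X) (γ : Set.powersetCard X n) :
    sigma s (φ * ψ) γ = sigma s φ γ * sigma s ψ (confMap φ⁻¹ γ) := by
  apply sigma_eq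
  intro i
  rw [mul_inv_rev, confMap_mul, sigma_spec, sigma_spec]
  rfl

variable [SecondCountableTopology X] [T2Space X]

theorem measurableSet_sigma (ψ : X ≃ₜ X) (τ : Equiv.Perm (Fin n)) :
    MeasurableSet {γ | sigma s ψ γ = τ} := by
  have : {γ | sigma s ψ γ = τ} =
      ⋂ i, {γ | (s.toFun (confMap ψ⁻¹ γ)).1 i = ψ⁻¹ ((s.toFun γ).1 (τ i))} := by
    ext γ
    simp only [Set.mem_ofPred_eq, Set.mem_iInter]
    exact ⟨fun h i => by rw [← h]; exact sigma_spec s ψ γ i, fun h => sigma_eq s h⟩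
  rw [this]
  have hs : ∀ i, Measurable fun γ => (s.toFun γ).1 i := fun i =>
    (measurable_pi_apply i).comp (measurable_subtype_coe.comp s.measurable_toFun)
  exact MeasurableSet.iInter fun i => measurableSet_eq_fun
    ((hs i).comp (measurable_confMap ψ⁻¹)) ((ψ⁻¹).measurable.comp (hs (τ i)))

end Conf

/-! ### The representation `V^q_m` -/

section Rep

variable {X : Type v} [TopologicalSpace X] [MeasurableSpace X] [BorelSpace X]

/-- The group of homeomorphisms of `X` with respect to which the measure `mⁿ` on the space of
`n`-point subsets is quasi-invariant. -/
def quasiInvGroup (m : Measure X) (n : ℕ) : Subgroup (X ≃ₜ X) where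
  carrier := {ψ | (confMeasure m n).map (confMap ψ) ≪ confMeasure m n ∧
    confMeasure m n ≪ (confMeasure m n).map (confMap ψ)}
  one_mem' := by
    have : (confMap (1 : X ≃ₜ X) : Set.powersetCard X n → _) = id := by
      ext1 γ; exact confMap_one γ
    simp [this, Measure.AbsolutelyContinuous.rfl]
  mul_mem' := by
    rintro φ ψ ⟨h1, h2⟩ ⟨h3, h4⟩
    have : (confMap (φ * ψ) : Set.powersetCard X n → _) = confMap φ ∘ confMap ψ := by
      ext1 γ; exact confMap_mul φ ψ γ
    simp only [Set.mem_ofPred_eq, this,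
      ← Measure.map_map (measurable_confMap φ) (measurable_confMap ψ)]
    exact ⟨(h3.map (measurable_confMap φ)).trans h1, h2.trans (h4.map (measurable_confMap φ))⟩
  inv_mem' := by
    rintro ψ ⟨h1, h2⟩
    have key : ((confMeasure m n).map (confMap ψ)).map (confMap ψ⁻¹) = confMeasure m n := by
      rw [Measure.map_map (measurable_confMap _) (measurable_confMap _)]
      have : (confMap ψ⁻¹ ∘ confMap ψ : Set.powersetCard X n → _) = id := by
        ext1 γ; exact confMap_inv_confMap ψ γ
      rw [this, Measure.map_id]
    constructor
    · have := h2.map (measurable_confMap ψ⁻¹)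
      rwa [key] at this
    · have := h1.map (measurable_confMap ψ⁻¹)
      rwa [key] at this

variable {m : Measure X} {n : ℕ}

theorem measurableEmbedding_distinctTuple [T2Space X] [SecondCountableTopology X] :
    MeasurableEmbedding (Subtype.val : DistinctTuple X n → Fin n → X) := by
  have hinj : MeasurableSet {x : Fin n → X | Function.Injective x} := by
    have : {x : Fin n → X | Function.Injective x} =
        ⋂ i, ⋂ j, {x | x i = x j → i = j} := by
      ext x; simp [Function.Injective]
    rw [this]
    refine MeasurableSet.iInter fun i => MeasurableSet.iInter fun j => ?_
    by_cases hij : i = j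
    · simp [hij]
    · have : {x : Fin n → X | x i = x j → i = j} = {x | x i = x j}ᶜ := by
        ext x; simp [hij]
      rw [this]
      exact (measurableSet_eq_fun (measurable_pi_apply i) (measurable_pi_apply j)).compl
  exact MeasurableEmbedding.subtype_coe hinj

theorem confMeasure_sigmaFinite (m : Measure X) [SigmaFinite m] (n : ℕ) [T2Space X]
    [SecondCountableTopology X] :
    SigmaFinite (confMeasure m n) := by
  let S : ℕ → Set (Set.powersetCard X n) := fun k => {γ | ∀ a ∈ (γ : Finset X), a ∈ spanningSets m k}
  have hpre : ∀ k, toSubset ⁻¹' S k =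
      (Subtype.val : DistinctTuple X n → Fin n → X) ⁻¹'
        (Set.pi Set.univ fun _ => spanningSets m k) := by
    intro k; ext x
    simp only [S, Set.mem_preimage, Set.mem_ofPred_eq, mem_toSubset, Set.mem_pi, Set.mem_univ,
      forall_true_left]
    exact ⟨fun h i => h _ ⟨i, rfl⟩, by rintro h _ ⟨i, rfl⟩; exact h i⟩
  have hmeas : ∀ k, MeasurableSet (S k) := by
    intro k
    change MeasurableSet (toSubset ⁻¹' S k)
    rw [hpre]
    exact measurable_subtype_coe
      (MeasurableSet.univ_pi fun _ => measurableSet_spanningSets m k)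
  refine ⟨⟨⟨S, fun _ => trivial, fun k => ?_, ?_⟩⟩⟩
  · rw [confMeasure, Measure.map_apply measurable_toSubset (hmeas k), hpre,
      measurableEmbedding_distinctTuple.comap_apply]
    refine lt_of_le_of_lt (measure_mono (Set.image_preimage_subset _ _)) ?_
    rw [Measure.pi_pi]
    exact ENNReal.prod_lt_top fun _ _ => measure_spanningSets_lt_top m k
  · rw [Set.eq_univ_iff_forall]
    intro γ
    have hex : ∀ a : X, ∃ k, a ∈ spanningSets m k := fun a =>
      ⟨_, mem_spanningSetsIndex m a⟩
    choose k hk using hex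
    refine Set.mem_iUnion.2 ⟨(γ : Finset X).sup k, fun a ha => ?_⟩
    exact monotone_spanningSets m (Finset.le_sup (f := k) ha) (hk a)

variable {W : Type w} [NormedAddCommGroup W] [InnerProductSpace ℂ W]

/-- The quasi-invariance factor `ρ(ψ, γ) = (mⁿ)^ψ(dγ) / mⁿ(dγ)`, where
`(mⁿ)^ψ(E) = mⁿ(ψ⁻¹ E)`. -/
def rho (m : Measure X) (ψ : X ≃ₜ X) (γ : Set.powersetCard X n) : ℝ≥0∞ :=
  ((confMeasure m n).map (confMap ψ)).rnDeriv (confMeasure m n) γ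

/-- The formula `(V^q_m(ψ) f)(γ) = ρ(ψ, γ)^{1/2} q(σ(ψ, γ)) f(ψ⁻¹(γ))`, for a function `f`. -/
def vFun (m : Measure X) (s : MeasurableSection X n) (q : Equiv.Perm (Fin n) →* (W ≃ₗᵢ[ℂ] W))
    (ψ : X ≃ₜ X) (f : Set.powersetCard X n → W) (γ : Set.powersetCard X n) : W :=
  ((√(rho m ψ γ).toReal : ℝ) : ℂ) • q (sigma s ψ γ) (f (confMap ψ⁻¹ γ))

variable (s : MeasurableSection X n) (q : Equiv.Perm (Fin n) →* (W ≃ₗᵢ[ℂ] W))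

theorem quasiMP_inv {ψ : X ≃ₜ X} (hψ : ψ ∈ quasiInvGroup m n) :
    Measure.QuasiMeasurePreserving (confMap ψ⁻¹) (confMeasure m n) (confMeasure m n) :=
  ⟨measurable_confMap _, ((quasiInvGroup m n).inv_mem hψ).1⟩

theorem vFun_congr {ψ : X ≃ₜ X} (hψ : ψ ∈ quasiInvGroup m n) {f g : Set.powersetCard X n → W}
    (h : f =ᵐ[confMeasure m n] g) : vFun m s q ψ f =ᵐ[confMeasure m n] vFun m s q ψ g := by
  have h' := (quasiMP_inv hψ).ae_eq_comp h
  filter_upwards [h'] with γ hγ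
  simp only [Function.comp_apply] at hγ
  simp only [vFun, hγ]

theorem measurable_rho (ψ : X ≃ₜ X) :
    Measurable (rho m ψ : Set.powersetCard X n → ℝ≥0∞) :=
  Measure.measurable_rnDeriv _ _

variable [SecondCountableTopology X] [T2Space X]

theorem aestronglyMeasurable_vFun {ψ : X ≃ₜ X} (hψ : ψ ∈ quasiInvGroup m n)
    {f : Set.powersetCard X n → W} (hf : AEStronglyMeasurable f (confMeasure m n)) :
    AEStronglyMeasurable (vFun m s q ψ f) (confMeasure m n) := by
  have h1 : AEStronglyMeasurable (fun γ => f (confMap ψ⁻¹ γ)) (confMeasure m n) :=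
    hf.comp_quasiMeasurePreserving (quasiMP_inv hψ)
  have h2 : AEStronglyMeasurable (fun γ => q (sigma s ψ γ) (f (confMap ψ⁻¹ γ)))
      (confMeasure m n) := by
    have : (fun γ => q (sigma s ψ γ) (f (confMap ψ⁻¹ γ))) = fun γ =>
        ∑ τ : Equiv.Perm (Fin n), Set.indicator {γ | sigma s ψ γ = τ}
          (fun γ => q τ (f (confMap ψ⁻¹ γ))) γ := by
      ext1 γ
      rw [Finset.sum_eq_single (sigma s ψ γ)]
      · simp
      · intro τ _ hτ
        exact Set.indicator_of_notMem (fun h => hτ h.symm) _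
      · simp
    rw [this]
    refine Finset.aestronglyMeasurable_fun_sum _ fun τ _ => ?_
    exact ((q τ).continuous.comp_aestronglyMeasurable h1).indicator (measurableSet_sigma s ψ τ)
  refine AEStronglyMeasurable.smul ?_ h2
  exact (Complex.measurable_ofReal.comp
    (Real.continuous_sqrt.measurable.comp (measurable_rho ψ).ennreal_toReal)).aestronglyMeasurable

variable [SigmaFinite m]

theorem rho_lt_top (m : Measure X) [SigmaFinite m] (ψ : X ≃ₜ X) :
    ∀ᵐ γ ∂(confMeasure m n), rho m ψ γ < ∞ := by
  have := confMeasure_sigmaFinite m n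
  have : SigmaFinite ((confMeasure m n).map (confMap ψ)) :=
    (confEquiv n ψ).measurableEmbedding.sigmaFinite_map
  exact Measure.rnDeriv_lt_top _ _

theorem withDensity_rho {ψ : X ≃ₜ X} (hψ : ψ ∈ quasiInvGroup m n) :
    (confMeasure m n).withDensity (rho m ψ) = (confMeasure m n).map (confMap ψ) := by
  have := confMeasure_sigmaFinite m n
  have : SigmaFinite ((confMeasure m n).map (confMap ψ)) :=
    (confEquiv n ψ).measurableEmbedding.sigmaFinite_map
  exact Measure.withDensity_rnDeriv_eq _ _ hψ.1

/-- The operators given by the formula preserve the `L²`-norm. -/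
theorem eLpNorm_vFun {ψ : X ≃ₜ X} (hψ : ψ ∈ quasiInvGroup m n)
    (f : Set.powersetCard X n → W) :
    eLpNorm (vFun m s q ψ f) 2 (confMeasure m n) = eLpNorm f 2 (confMeasure m n) := by
  rw [eLpNorm_eq_lintegral_rpow_enorm_toReal two_ne_zero ENNReal.ofNat_ne_top,
    eLpNorm_eq_lintegral_rpow_enorm_toReal two_ne_zero ENNReal.ofNat_ne_top]
  congr 1
  have h1 : ∫⁻ γ, ‖vFun m s q ψ f γ‖ₑ ^ (2 : ℝ≥0∞).toReal ∂(confMeasure m n) =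
      ∫⁻ γ, rho m ψ γ * ‖f (confMap ψ⁻¹ γ)‖ₑ ^ (2 : ℝ≥0∞).toReal ∂(confMeasure m n) := by
    refine lintegral_congr_ae ?_
    filter_upwards [rho_lt_top (n := n) m ψ] with γ hγ
    have hr : ‖((√(rho m ψ γ).toReal : ℝ) : ℂ)‖ₑ ^ (2 : ℝ) = rho m ψ γ := by
      rw [← ofReal_norm, Complex.norm_real, Real.norm_of_nonneg (Real.sqrt_nonneg _),
        ENNReal.ofReal_rpow_of_nonneg (Real.sqrt_nonneg _) zero_le_two, Real.rpow_two,
        Real.sq_sqrt ENNReal.toReal_nonneg, ENNReal.ofReal_toReal hγ.ne]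
    have hq : ‖q (sigma s ψ γ) (f (confMap ψ⁻¹ γ))‖ₑ = ‖f (confMap ψ⁻¹ γ)‖ₑ := by
      rw [← ofReal_norm, LinearIsometryEquiv.norm_map, ofReal_norm]
    simp only [vFun, enorm_smul, ENNReal.toReal_ofNat]
    rw [ENNReal.mul_rpow_of_nonneg _ _ zero_le_two, hr, hq]
  rw [h1]
  have h2 := lintegral_withDensity_eq_lintegral_mul_non_measurable₀ (confMeasure m n)
    (f := rho m ψ) (measurable_rho ψ).aemeasurable (rho_lt_top m ψ)
    (fun γ => ‖f (confMap ψ⁻¹ γ)‖ₑ ^ (2 : ℝ≥0∞).toReal)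
  simp only [Pi.mul_apply] at h2
  rw [← h2, withDensity_rho hψ]
  have h3 := MeasureTheory.lintegral_map_equiv (μ := confMeasure m n)
    (fun γ => ‖f (confMap ψ⁻¹ γ)‖ₑ ^ (2 : ℝ≥0∞).toReal) (confEquiv n ψ)
  rw [show (confMap ψ : Set.powersetCard X n → _) = confEquiv n ψ from rfl, h3]
  simp [confEquiv]

theorem memLp_vFun {ψ : X ≃ₜ X} (hψ : ψ ∈ quasiInvGroup m n) {f : Set.powersetCard X n → W}
    (hf : MemLp f 2 (confMeasure m n)) : MemLp (vFun m s q ψ f) 2 (confMeasure m n) :=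
  ⟨aestronglyMeasurable_vFun s q hψ hf.1, by rw [eLpNorm_vFun s q hψ]; exact hf.2⟩

/-- The chain rule for the quasi-invariance factor. -/
theorem rho_mul {φ ψ : X ≃ₜ X} (hφ : φ ∈ quasiInvGroup m n) (hψ : ψ ∈ quasiInvGroup m n) :
    (rho m (φ * ψ) : Set.powersetCard X n → ℝ≥0∞) =ᵐ[confMeasure m n]
      fun γ => rho m φ γ * rho m ψ (confMap φ⁻¹ γ) := by
  have := confMeasure_sigmaFinite m n
  have hc : (confMap (φ * ψ) : Set.powersetCard X n → _) = confMap φ ∘ confMap ψ := by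
    ext1 γ; exact confMap_mul φ ψ γ
  have hmψ : Measurable fun γ : Set.powersetCard X n => rho m ψ (confMap φ⁻¹ γ) :=
    (measurable_rho ψ).comp (measurable_confMap _)
  have key : (confMeasure m n).map (confMap (φ * ψ)) =
      (confMeasure m n).withDensity (fun γ => rho m φ γ * rho m ψ (confMap φ⁻¹ γ)) := by
    have e1 : (confMeasure m n).withDensity (fun γ => rho m φ γ * rho m ψ (confMap φ⁻¹ γ)) =
        ((confMeasure m n).map (confMap φ)).withDensity (fun γ => rho m ψ (confMap φ⁻¹ γ)) := by
      rw [← withDensity_rho hφ]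
      exact withDensity_mul _ (measurable_rho φ) hmψ
    rw [e1, hc, ← Measure.map_map (measurable_confMap φ) (measurable_confMap ψ),
      ← withDensity_rho hψ]
    ext E hE
    rw [Measure.map_apply (measurable_confMap φ) hE,
      withDensity_apply _ (measurable_confMap φ hE), withDensity_apply _ hE,
      setLIntegral_map hE hmψ (measurable_confMap φ)]
    simp
  change ((confMeasure m n).map (confMap (φ * ψ))).rnDeriv (confMeasure m n) =ᵐ[_] _
  rw [key]
  exact Measure.rnDeriv_withDensity _ ((measurable_rho φ).mul hmψ)

theorem rho_one : (rho m 1 : Set.powersetCard X n → ℝ≥0∞) =ᵐ[confMeasure m n] 1 := by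
  have := confMeasure_sigmaFinite m n
  have hc : (confMap (1 : X ≃ₜ X) : Set.powersetCard X n → _) = id := by
    ext1 γ; exact confMap_one γ
  change ((confMeasure m n).map (confMap 1)).rnDeriv (confMeasure m n) =ᵐ[_] _
  rw [hc, Measure.map_id]
  exact Measure.rnDeriv_self _

theorem vFun_mul {φ ψ : X ≃ₜ X} (hφ : φ ∈ quasiInvGroup m n) (hψ : ψ ∈ quasiInvGroup m n)
    (f : Set.powersetCard X n → W) :
    vFun m s q (φ * ψ) f =ᵐ[confMeasure m n] vFun m s q φ (vFun m s q ψ f) := by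
  filter_upwards [rho_mul hφ hψ] with γ hγ
  simp only [vFun, hγ, sigma_mul, map_mul, mul_inv_rev, confMap_mul, ENNReal.toReal_mul,
    Real.sqrt_mul ENNReal.toReal_nonneg, Complex.ofReal_mul, map_smul, smul_smul]
  rfl

theorem vFun_one (f : Set.powersetCard X n → W) :
    vFun m s q 1 f =ᵐ[confMeasure m n] f := by
  filter_upwards [rho_one (m := m) (n := n)] with γ hγ
  simp [vFun, hγ, sigma_one, confMap_one]

/-- The operator `V^q_m(ψ)` on `L²`. -/
def vLin {ψ : X ≃ₜ X} (hψ : ψ ∈ quasiInvGroup m n) :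
    Lp W 2 (confMeasure m n) →ₗ[ℂ] Lp W 2 (confMeasure m n) where
  toFun f := (memLp_vFun s q hψ (Lp.memLp f)).toLp
  map_add' f g := by
    rw [← MemLp.toLp_add, MemLp.toLp_eq_toLp_iff]
    refine (vFun_congr s q hψ (Lp.coeFn_add f g)).trans (ae_of_all _ fun γ => ?_)
    simp [vFun]
  map_smul' c f := by
    rw [RingHom.id_apply, ← MemLp.toLp_const_smul, MemLp.toLp_eq_toLp_iff]
    refine (vFun_congr s q hψ (Lp.coeFn_smul c f)).trans (ae_of_all _ fun γ => ?_)
    simp [vFun, smul_comm c]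

theorem coeFn_vLin {ψ : X ≃ₜ X} (hψ : ψ ∈ quasiInvGroup m n) (f : Lp W 2 (confMeasure m n)) :
    vLin s q hψ f =ᵐ[confMeasure m n] vFun m s q ψ f :=
  MemLp.coeFn_toLp (memLp_vFun s q hψ (Lp.memLp f))

theorem norm_vLin {ψ : X ≃ₜ X} (hψ : ψ ∈ quasiInvGroup m n) (f : Lp W 2 (confMeasure m n)) :
    ‖vLin s q hψ f‖ = ‖f‖ := by
  rw [Lp.norm_def, Lp.norm_def, eLpNorm_congr_ae (coeFn_vLin s q hψ f), eLpNorm_vFun s q hψ]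

theorem vLin_mul {φ ψ : X ≃ₜ X} (hφ : φ ∈ quasiInvGroup m n) (hψ : ψ ∈ quasiInvGroup m n)
    (f : Lp W 2 (confMeasure m n)) :
    vLin s q (mul_mem hφ hψ) f = vLin s q hφ (vLin s q hψ f) := by
  apply Lp.ext
  exact (coeFn_vLin s q _ f).trans <| (vFun_mul s q hφ hψ f).trans <|
    (vFun_congr s q hφ (coeFn_vLin s q hψ f)).symm.trans (coeFn_vLin s q hφ _).symm

theorem vLin_one (h : (1 : X ≃ₜ X) ∈ quasiInvGroup m n) (f : Lp W 2 (confMeasure m n)) :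
    vLin s q h f = f :=
  Lp.ext ((coeFn_vLin s q _ f).trans (vFun_one s q f))

/-- The unitary representation `V^q_m` in `L²(B^n_X, mⁿ, W)`, where `B^n_X` is the space of
`n`-point subsets of `X` and `q` is a unitary representation in `W` of the symmetric group:
`(V^q_m(ψ) f)(γ) = ρ(ψ, γ)^{1/2} q(σ(ψ, γ)) f(ψ⁻¹(γ))` for almost all `γ`. -/
def repV (m : Measure X) [SigmaFinite m] (s : MeasurableSection X n)
    (q : Equiv.Perm (Fin n) →* (W ≃ₗᵢ[ℂ] W)) :
    quasiInvGroup m n →* (Lp W 2 (confMeasure m n) ≃ₗᵢ[ℂ] Lp W 2 (confMeasure m n)) where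
  toFun ψ :=
    { toLinearEquiv := LinearEquiv.ofLinearMap (vLin s q ψ.2) (vLin s q (inv_mem ψ.2))
        (by
          ext1 f
          have h := vLin_mul s q ψ.2 (inv_mem ψ.2) f
          simp only [mul_inv_cancel] at h
          rw [LinearMap.comp_apply, ← h, vLin_one]; rfl)
        (by
          ext1 f
          have h := vLin_mul s q (inv_mem ψ.2) ψ.2 f
          simp only [inv_mul_cancel] at h
          rw [LinearMap.comp_apply, ← h, vLin_one]; rfl)
      norm_map' := norm_vLin s q ψ.2 }
  map_one' := by ext1 f; exact vLin_one s q (one_mem _) f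
  map_mul' φ ψ := by ext1 f; exact vLin_mul s q φ.2 ψ.2 f

theorem coeFn_repV (s : MeasurableSection X n) (q : Equiv.Perm (Fin n) →* (W ≃ₗᵢ[ℂ] W))
    (ψ : quasiInvGroup m n) (f : Lp W 2 (confMeasure m n)) :
    repV m s q ψ f =ᵐ[confMeasure m n] fun γ =>
      ((√(rho m ψ.1 γ).toReal : ℝ) : ℂ) • q (sigma s ψ.1 γ) (f (confMap ψ.1⁻¹ γ)) :=
  coeFn_vLin s q ψ.2 f

/-- A homeomorphism preserving `m` preserves `mⁿ`. -/
theorem map_confMeasure_of_map_eq {ψ : X ≃ₜ X} (h : m.map ψ = m) :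
    (confMeasure m n).map (confMap ψ) = confMeasure m n := by
  have hemb : MeasurableEmbedding (Subtype.val : DistinctTuple X n → Fin n → X) :=
    measurableEmbedding_distinctTuple
  have hpi : MeasurePreserving (fun (x : Fin n → X) i => ψ (x i))
      (Measure.pi fun _ => m) (Measure.pi fun _ => m) :=
    measurePreserving_pi _ _ fun _ => ⟨ψ.measurable, h⟩
  ext E hE
  have hE' : MeasurableSet (toSubset ⁻¹' E : Set (DistinctTuple X n)) := measurable_toSubset hE
  rw [Measure.map_apply (measurable_confMap ψ) hE, confMeasure,
    Measure.map_apply measurable_toSubset (measurable_confMap ψ hE),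
    Measure.map_apply measurable_toSubset hE, hemb.comap_apply, hemb.comap_apply,
    ← hpi.measure_preimage (hemb.measurableSet_image.2 hE').nullMeasurableSet]
  congr 1
  ext x
  simp only [Set.mem_image, Set.mem_preimage]
  constructor
  · rintro ⟨y, hy, rfl⟩
    exact ⟨tupleMap ψ y, by rwa [← confMap_toSubset], rfl⟩
  · rintro ⟨y, hy, hyx⟩
    have hx : Function.Injective x := by
      intro a b hab
      apply y.2
      rw [hyx]
      exact congrArg ψ hab
    refine ⟨⟨x, hx⟩, ?_, rfl⟩
    rw [confMap_toSubset]
    have : tupleMap ψ ⟨x, hx⟩ = y := Subtype.ext hyx.symm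
    rwa [this]

theorem mem_quasiInvGroup_of_map_eq {ψ : X ≃ₜ X} (h : m.map ψ = m) : ψ ∈ quasiInvGroup m n :=
  have := map_confMeasure_of_map_eq (n := n) h
  ⟨this.le.absolutelyContinuous, this.ge.absolutelyContinuous⟩

end Rep

/-! ### Haar measure on open subsets of `K^d` -/

section Haar

variable {K : Type u} [NontriviallyNormedField K] [ProperSpace K] [MeasurableSpace K] [BorelSpace K]

/-- The Haar measure on `K^d` (with the maximum norm) normalised by giving the closed unit ball
measure `1`. -/
def unitBallHaar (K : Type u) [NontriviallyNormedField K] [ProperSpace K] [MeasurableSpace K]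
    [BorelSpace K] (d : ℕ) : Measure (Fin d → K) :=
  Measure.addHaarMeasure
    { carrier := Metric.closedBall 0 1
      isCompact' := isCompact_closedBall 0 1
      interior_nonempty' :=
        ⟨0, Metric.ball_subset_interior_closedBall (Metric.mem_ball_self one_pos)⟩ }

theorem unitBallHaar_closedBall (d : ℕ) :
    unitBallHaar K d (Metric.closedBall 0 1) = 1 :=
  Measure.addHaarMeasure_self

/-- The restriction to an open subset `X` of `K^d` of the normalised Haar measure. -/
def openHaar {d : ℕ} (X : TopologicalSpace.Opens (Fin d → K)) : Measure X :=
  (unitBallHaar K d).comap (Subtype.val : X → Fin d → K)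

instance {d : ℕ} (X : TopologicalSpace.Opens (Fin d → K)) : SigmaFinite (openHaar X) := by
  have : (unitBallHaar K d).IsAddHaarMeasure := by unfold unitBallHaar; infer_instance
  have hemb : MeasurableEmbedding (Subtype.val : X → Fin d → K) :=
    MeasurableEmbedding.subtype_coe X.isOpen.measurableSet
  refine ⟨⟨⟨fun k => Subtype.val ⁻¹' spanningSets (unitBallHaar K d) k, fun _ => trivial,
    fun k => ?_, ?_⟩⟩⟩
  · rw [openHaar, hemb.comap_apply]
    exact (measure_mono (Set.image_preimage_subset _ _)).trans_lt
      (measure_spanningSets_lt_top _ k)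
  · rw [← Set.preimage_iUnion, iUnion_spanningSets, Set.preimage_univ]

end Haar

/-! ### Maps of class `C^t` over a valued field -/

/-- `IsCDiffAux K b k U f` says that `f` is of class `C^{k+b}` on the open set `U`, where `k` is a
natural number and `0 ≤ b < 1`, in the sense of non-Archimedean analysis, i.e. through continuous
extensions of iterated difference quotients.

* `f` is of class `C^b` if near each point of `U` the difference `f x - f y` is
  `o(‖x - y‖ ^ b)`; for `b = 0` this says that `f` is continuous.
* `f` is of class `C^{k+1+b}` if its difference quotient `(f (x + τ v) - f x) / τ` (`τ ≠ 0`) extends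
  to a map of class `C^{k+b}` on the open set `{(x, v, τ) | x ∈ U, x + τ v ∈ U}`. -/
def IsCDiffAux (K : Type u) [NontriviallyNormedField K] {F : Type v} [NormedAddCommGroup F]
    [NormedSpace K F] (b : ℝ) :
    ℕ → ∀ {E : Type u} [NormedAddCommGroup E] [NormedSpace K E], Set E → (E → F) → Prop
  | 0, _, _, _, U, f =>
      ∀ a ∈ U, ∀ ε > 0, ∀ᶠ p in 𝓝[U] a ×ˢ 𝓝[U] a, ‖f p.1 - f p.2‖ ≤ ε * ‖p.1 - p.2‖ ^ b
  | k + 1, E, _, _, U, f =>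
      ∃ g : E × E × K → F,
        IsCDiffAux K b k {p : E × E × K | p.1 ∈ U ∧ p.1 + p.2.2 • p.2.1 ∈ U} g ∧
        ∀ (x v : E) (τ : K), x ∈ U → x + τ • v ∈ U → τ • g (x, v, τ) = f (x + τ • v) - f x

/-- The class `C^t`, `0 ≤ t ≤ ∞`: for `t = ∞` it is the intersection of the classes `C^k`, `k ∈ ℕ`,
and a finite `t` is written as `t = ⌊t⌋ + b` with `0 ≤ b < 1`. -/
def IsCDiff (K : Type u) [NontriviallyNormedField K] {E : Type u} [NormedAddCommGroup E]
    [NormedSpace K E] {F : Type v} [NormedAddCommGroup F] [NormedSpace K F]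
    (t : ℝ≥0∞) (U : Set E) (f : E → F) : Prop :=
  (t = ∞ → ∀ k : ℕ, IsCDiffAux K 0 k U f) ∧
  (t ≠ ∞ → IsCDiffAux K (t.toReal - ⌊t.toReal⌋₊) ⌊t.toReal⌋₊ U f)

section Diff

variable {K : Type u} [NontriviallyNormedField K] {d : ℕ}

/-- A self-homeomorphism of an open set `X ⊆ K^d` is of class `C^t` if it is so as a map into `K^d`
(its values off `X` play no role and are set to `0`). -/
def IsCHomeo (t : ℝ≥0∞) (X : TopologicalSpace.Opens (Fin d → K)) (ψ : X ≃ₜ X) : Prop :=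
  IsCDiff K t (X : Set (Fin d → K))
    (Function.extend (Subtype.val : X → Fin d → K) (fun x => (ψ x : Fin d → K)) 0)

/-- `Diff^t(X)`: the `C^t`-diffeomorphisms of `X`. -/
def diffC (t : ℝ≥0∞) (X : TopologicalSpace.Opens (Fin d → K)) : Set (X ≃ₜ X) :=
  {ψ | IsCHomeo t X ψ ∧ IsCHomeo t X ψ⁻¹}

/-- `Diff^t(X, m)`: the `C^t`-diffeomorphisms `ψ` of `X` that preserve the Haar measure `m` of `X`,
i.e. for which the density of `m^ψ(E) = m(ψ⁻¹ E)` with respect to `m` is `1`. -/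
def diffCMeas [ProperSpace K] [MeasurableSpace K] [BorelSpace K]
    (t : ℝ≥0∞) (X : TopologicalSpace.Opens (Fin d → K)) : Set (X ≃ₜ X) :=
  {ψ | ψ ∈ diffC t X ∧ (openHaar X).map ψ = openHaar X}

/-- `Diff^t(X, m)` is contained in the group on which `V^q_m` is defined. -/
theorem diffCMeas_subset [ProperSpace K] [MeasurableSpace K] [BorelSpace K]
    (t : ℝ≥0∞) (X : TopologicalSpace.Opens (Fin d → K)) (n : ℕ) :
    diffCMeas t X ⊆ quasiInvGroup (openHaar X) n :=
  fun _ h => mem_quasiInvGroup_of_map_eq h.2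

end Diff

end

/-! Swaps of two disjoint closed balls of equal radius by translations already force irreducibility.
They preserve Haar measure, and since closed balls are clopen they are locally translations, hence
of class `C^t` for every `t` (`isCDiffAux_of_isRationalGerm`). It suffices that every bounded
operator `A` whose sesquilinear form is invariant under swaps is a scalar
(`IsSwapInvariant.exists_eq_smul`): the orthogonal projection onto a closed invariant subspace is
such an `A`, and a scalar projection is `0` or `1`.

A box is a product of `n` disjoint closed balls of one radius `r` contained in `X`, that is, a
closed ball in `Xⁿ` for the maximum metric. To a box and `w ∈ W` belongs the function on `n`-point
subsets with value `q(κ) w` where the enumeration `s(γ) κ` lies in the box, and `0` elsewhere. A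
measure-preserving homeomorphism acts on such vectors by moving the underlying set (`repV_boxVec`),
permuting the balls replaces `w` by `q(κ) w` (`IsBoxCenter.boxVec_perm`), and the vectors of all
boxes span a dense subspace (`iSup_boxSpan_dense`).

For fixed `r` the swaps act transitively on boxes. Permuted boxes are included, so the form of `A`
on the vectors of one box is `q`-invariant, and Schur's lemma makes it a constant multiple of the
inner product of `W`, with a constant depending on `r` only. If two boxes are not permutations of
each other, some ball of the second is disjoint from all balls of the first. As `X` has infinite
measure, that ball can be carried out of any given compact set, in small pieces, while the first box
stays fixed. The matrix coefficient of `A` does not change, yet it is arbitrarily small, since an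
element of `L²` is almost orthogonal to vectors supported far out. Hence it is `0`
(`IsSwapInvariant.inner_box_eq_zero`).

The same holds for the identity operator, so on the span of the boxes of radius `r` the form of `A`
is a multiple of the inner product. Each box is a finite disjoint union of smaller ones, so these
spans grow as `r` decreases, the multiples agree, and density finishes the proof. -/

/-! ### Rational germs are of class `C^∞` -/

section RationalGerms

variable {K : Type u} [NontriviallyNormedField K]

/-- `IsRationalGerm a f` says that near `a` the scalar function `f` is given by an expression built
from constants and continuous linear forms by means of field operations. -/
inductive IsRationalGerm {E : Type u} [NormedAddCommGroup E] [NormedSpace K E] (a : E) :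
    (E → K) → Prop
  | const (c : K) : IsRationalGerm a fun _ => c
  | linear (l : E →L[K] K) : IsRationalGerm a fun x => l x
  | add {f g : E → K} : IsRationalGerm a f → IsRationalGerm a g →
      IsRationalGerm a fun x => f x + g x
  | mul {f g : E → K} : IsRationalGerm a f → IsRationalGerm a g →
      IsRationalGerm a fun x => f x * g x
  | inv {f : E → K} : IsRationalGerm a f → f a ≠ 0 → IsRationalGerm a fun x => (f x)⁻¹
  | congr {f g : E → K} : IsRationalGerm a f → f =ᶠ[𝓝 a] g → IsRationalGerm a g

namespace IsRationalGerm

variable {E : Type u} [NormedAddCommGroup E] [NormedSpace K E]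

theorem analyticAt [CompleteSpace K] {a : E} {f : E → K} (h : IsRationalGerm a f) :
    AnalyticAt K f a := by
  induction h with
  | const c => exact analyticAt_const
  | linear l => exact l.analyticAt a
  | add _ _ hf hg => exact hf.fun_add hg
  | mul _ _ hf hg => exact hf.fun_mul hg
  | inv _ h hf => exact hf.fun_inv h
  | congr _ h hf => exact hf.congr h

theorem sub {a : E} {f g : E → K} (hf : IsRationalGerm a f) (hg : IsRationalGerm a g) :
    IsRationalGerm a fun x => f x - g x :=
  (hf.add ((const (-1)).mul hg)).congr (Eventually.of_forall fun x => by ring)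

theorem continuous_shift : Continuous fun p : E × E × K => p.1 + p.2.2 • p.2.1 := by
  fun_prop

theorem tendsto_shift (p : E × E × K) :
    Tendsto (fun p : E × E × K => p.1 + p.2.2 • p.2.1) (𝓝 p) (𝓝 (p.1 + p.2.2 • p.2.1)) :=
  continuous_shift.tendsto p

/-- Together with `step` and `comp_shift` this keeps difference quotients with nonzero step inside
the class. Affine germs would not do: if `x` and `x + τ v` lie in pieces translated by different
vectors, the quotient involves `τ⁻¹`. -/
theorem comp_fst {p : E × E × K} {f : E → K} (h : IsRationalGerm p.1 f) :
    IsRationalGerm p fun p => f p.1 := by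
  induction h with
  | const c => exact const c
  | linear l => exact linear (l.comp (ContinuousLinearMap.fst K E (E × K)))
  | add _ _ hf hg => exact hf.add hg
  | mul _ _ hf hg => exact hf.mul hg
  | inv _ h hf => exact hf.inv h
  | congr _ h hf => exact hf.congr (continuous_fst.tendsto p h)

theorem step (p : E × E × K) : IsRationalGerm p fun p => p.2.2 :=
  linear ((ContinuousLinearMap.snd K E K).comp (ContinuousLinearMap.snd K E (E × K)))

theorem comp_shift {p : E × E × K} {f : E → K} (h : IsRationalGerm (p.1 + p.2.2 • p.2.1) f) :
    IsRationalGerm p fun p => f (p.1 + p.2.2 • p.2.1) := by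
  induction h with
  | const c => exact const c
  | linear l =>
    have h1 : IsRationalGerm p fun p : E × E × K => l p.1 :=
      linear (l.comp (ContinuousLinearMap.fst K E (E × K)))
    have h2 : IsRationalGerm p fun p : E × E × K => l p.2.1 :=
      linear (l.comp ((ContinuousLinearMap.fst K E K).comp (ContinuousLinearMap.snd K E (E × K))))
    exact (h1.add ((step p).mul h2)).congr (Eventually.of_forall fun p => by simp)
  | add _ _ hf hg => exact hf.add hg
  | mul _ _ hf hg => exact hf.mul hg
  | inv _ h hf => exact hf.inv h
  | congr _ h hf => exact hf.congr (tendsto_shift p h)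

/-- The difference quotient of a rational germ extends to a rational germ at the points with zero
step. -/
theorem exists_diffQuot [CompleteSpace K] {a : E} {f : E → K} (hf : IsRationalGerm a f) (v : E) :
    ∃ g : E × E × K → K, IsRationalGerm (a, v, (0 : K)) g ∧
      ∀ᶠ p in 𝓝 (a, v, (0 : K)), p.2.2 * g p = f (p.1 + p.2.2 • p.2.1) - f p.1 := by
  have hsh : ∀ {f : E → K}, IsRationalGerm a f →
      IsRationalGerm (a, v, (0 : K)) fun p => f (p.1 + p.2.2 • p.2.1) := fun h =>
    comp_shift (by simpa using h)
  have hfst : ∀ {f : E → K}, IsRationalGerm a f →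
      IsRationalGerm (a, v, (0 : K)) fun p => f p.1 := fun h => comp_fst h
  induction hf with
  | const c => exact ⟨fun _ => 0, const 0, Eventually.of_forall fun p => by simp⟩
  | linear l =>
    exact ⟨_, linear (l.comp ((ContinuousLinearMap.fst K E K).comp
      (ContinuousLinearMap.snd K E (E × K)))), Eventually.of_forall fun p => by simp⟩
  | add _ _ hf hg =>
    obtain ⟨g₁, h₁, e₁⟩ := hf
    obtain ⟨g₂, h₂, e₂⟩ := hg
    refine ⟨_, h₁.add h₂, ?_⟩
    filter_upwards [e₁, e₂] with p h h'
    rw [mul_add, h, h']; ring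
  | @mul f₁ f₂ hf₁ hf₂ hf hg =>
    obtain ⟨g₁, h₁, e₁⟩ := hf
    obtain ⟨g₂, h₂, e₂⟩ := hg
    refine ⟨_, (h₁.mul (hsh hf₂)).add ((hfst hf₁).mul h₂), ?_⟩
    filter_upwards [e₁, e₂] with p h h'
    rw [mul_add, ← mul_assoc, h, mul_left_comm, h']; ring
  | @inv f hf h0 hg =>
    obtain ⟨g, hg, e⟩ := hg
    have hs := hsh hf
    have ht := hfst hf
    have e0 : f ((a, v, (0 : K)).1 + (a, v, (0 : K)).2.2 • (a, v, (0 : K)).2.1) ≠ 0 := by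
      simpa using h0
    refine ⟨_, ((const (-1)).mul hg).mul ((hs.inv e0).mul (ht.inv h0)), ?_⟩
    filter_upwards [e, hs.analyticAt.continuousAt.eventually_ne e0,
      ht.analyticAt.continuousAt.eventually_ne h0] with p h h1 h2
    rw [show ∀ x y z t : K, x * (-1 * y * (z * t)) = -(x * y) * (z * t) by intros; ring, h]
    field_simp
    ring
  | congr hf hfg hg =>
    obtain ⟨g, hg, e⟩ := hg
    refine ⟨g, hg, ?_⟩
    have e0 : (a, v, (0 : K)).1 + (a, v, (0 : K)).2.2 • (a, v, (0 : K)).2.1 = a := by simp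
    have h1 := (tendsto_shift (a, v, (0 : K))).eventually (e0.symm ▸ hfg)
    have h2 := continuous_fst.tendsto (a, v, (0 : K)) |>.eventually hfg
    filter_upwards [e, h1, h2] with p h h1 h2
    rw [h, h1, h2]

end IsRationalGerm

/-- Strict differentiability gives a local Lipschitz bound `C ‖x - y‖`, and since `b < 1` this is `C
‖x - y‖ ^ (1 - b)` times `‖x - y‖ ^ b` with a first factor tending to `0`. -/
theorem isCDiffAux_zero_of_hasStrictFDerivAt {E : Type u} [NormedAddCommGroup E] [NormedSpace K E]
    {F : Type v} [NormedAddCommGroup F] [NormedSpace K F] {b : ℝ} (hb1 : b < 1)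
    {U : Set E} {f : E → F} (hf : ∀ a ∈ U, ∃ f' : E →L[K] F, HasStrictFDerivAt f f' a) :
    IsCDiffAux K b 0 U f := by
  intro a ha ε hε
  obtain ⟨f', hf'⟩ := hf a ha
  obtain ⟨C, s, hs, hC⟩ := hf'.exists_lipschitzOnWith
  have hlim : Tendsto (fun p : E × E => (C : ℝ) * ‖p.1 - p.2‖ ^ (1 - b)) (𝓝 a ×ˢ 𝓝 a) (𝓝 0) := by
    have : Tendsto (fun p : E × E => ‖p.1 - p.2‖) (𝓝 a ×ˢ 𝓝 a) (𝓝 0) := by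
      have : Continuous fun p : E × E => ‖p.1 - p.2‖ := by fun_prop
      rw [← nhds_prod_eq]
      simpa using this.tendsto (a, a)
    have h2 := (this.rpow_const (p := 1 - b) (Or.inr (by linarith))).const_mul (C : ℝ)
    rwa [Real.zero_rpow (by linarith), mul_zero] at h2
  have key : ∀ᶠ p in 𝓝 a ×ˢ 𝓝 a, ‖f p.1 - f p.2‖ ≤ ε * ‖p.1 - p.2‖ ^ b := by
    filter_upwards [prod_mem_prod hs hs, hlim.eventually (gt_mem_nhds hε)] with p hp hp'
    have h1 := hC.norm_sub_le hp.1 hp.2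
    refine h1.trans ?_
    rcases eq_or_ne (p.1 - p.2) 0 with h0 | h0
    · rw [h0]; simp only [norm_zero, mul_zero]; positivity
    · have hpos : 0 < ‖p.1 - p.2‖ := norm_pos_iff.2 h0
      have : ‖p.1 - p.2‖ = ‖p.1 - p.2‖ ^ (1 - b) * ‖p.1 - p.2‖ ^ b := by
        rw [← Real.rpow_add hpos]; simp
      rw [this, ← mul_assoc, ← this]
      exact mul_le_mul_of_nonneg_right hp'.le (by positivity)
  exact key.filter_mono (Filter.prod_mono nhdsWithin_le_nhds nhdsWithin_le_nhds)

/-- Induction on `k` with the domain `E` varying: the extended difference quotient is again a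
rational germ at every point of its domain, by `exists_diffQuot` where the step vanishes and by
direct division elsewhere. -/
theorem isCDiffAux_of_isRationalGerm [CompleteSpace K] {ι : Type v} [Fintype ι] {b : ℝ}
    (hb1 : b < 1) (k : ℕ) {E : Type u} [NormedAddCommGroup E] [NormedSpace K E]
    {U : Set E} {f : E → ι → K} (hf : ∀ a ∈ U, ∀ i, IsRationalGerm a fun x => f x i) :
    IsCDiffAux K b k U f := by
  classical
  induction k generalizing E with
  | zero =>
    refine isCDiffAux_zero_of_hasStrictFDerivAt hb1 fun a ha => ?_
    exact ⟨_, hasStrictFDerivAt_pi.2 fun i => (hf a ha i).analyticAt.hasStrictFDerivAt⟩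
  | succ k ih =>
    let Q : E × E × K → ι → K := fun p i => p.2.2⁻¹ * (f (p.1 + p.2.2 • p.2.1) i - f p.1 i)
    -- The extensions from `exists_diffQuot` depend on the base point. Their values at `τ = 0` are
    -- forced by continuity, so taking the limit there gives one function agreeing with all of them
    -- locally.
    let g : E × E × K → ι → K := fun p i =>
      if p.2.2 = 0 then limUnder (𝓝[≠] (0 : K)) fun τ => Q (p.1, p.2.1, τ) i else Q p i
    refine ⟨g, ih ?_, ?_⟩
    · rintro ⟨x, v, τ⟩ ⟨hx, hxv⟩ i
      simp only at hx hxv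
      rcases eq_or_ne τ 0 with rfl | hτ
      · obtain ⟨h, hh, e⟩ := (hf x hx i).exists_diffQuot v
        refine hh.congr ?_
        filter_upwards [e.eventually_nhds, hh.analyticAt.eventually_analyticAt] with p hp hc
        obtain ⟨y, w, σ⟩ := p
        simp only [g, Q]
        split_ifs with h0
        · subst h0
          symm
          refine Tendsto.limUnder_eq ?_
          have hcurve : Tendsto (fun τ : K => (y, w, τ)) (𝓝[≠] 0) (𝓝 (y, w, (0 : K))) :=
            (Continuous.tendsto (by fun_prop) (0 : K)).mono_left nhdsWithin_le_nhds
          refine (hc.continuousAt.tendsto.comp hcurve).congr' ?_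
          filter_upwards [hcurve.eventually hp, self_mem_nhdsWithin] with τ h1 h2
          have h1' : τ * h (y, w, τ) = f (y + τ • w) i - f y i := h1
          rw [← h1', inv_mul_cancel_left₀ h2]; rfl
        · have hp' : σ * h (y, w, σ) = f (y + σ • w) i - f y i := hp.self_of_nhds
          rw [← hp', inv_mul_cancel_left₀ h0]
      · have h1 : IsRationalGerm (x, v, τ) fun p => Q p i :=
          ((IsRationalGerm.step _).inv hτ).mul
            ((IsRationalGerm.comp_shift (p := (x, v, τ)) (hf _ hxv i)).sub
              (IsRationalGerm.comp_fst (p := (x, v, τ)) (hf x hx i)))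
        refine h1.congr ?_
        have : ∀ᶠ p : E × E × K in 𝓝 (x, v, τ), p.2.2 ≠ 0 :=
          (Continuous.continuousAt (by fun_prop)).eventually_ne hτ
        filter_upwards [this] with p hp
        simp [g, hp]
    · intro x v τ _ _
      ext i
      rcases eq_or_ne τ 0 with rfl | hτ
      · simp
      · simp [g, Q, hτ]

theorem isCDiff_of_isRationalGerm [CompleteSpace K] {ι : Type v} [Fintype ι] (t : ℝ≥0∞)
    {E : Type u} [NormedAddCommGroup E] [NormedSpace K E]
    {U : Set E} {f : E → ι → K} (hf : ∀ a ∈ U, ∀ i, IsRationalGerm a fun x => f x i) :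
    IsCDiff K t U f :=
  ⟨fun _ k => isCDiffAux_of_isRationalGerm one_pos k hf, fun _ =>
    isCDiffAux_of_isRationalGerm (by linarith [Nat.lt_floor_add_one t.toReal]) _ hf⟩

/-- A homeomorphism of an open set that is locally a translation is of class `C^t`. -/
theorem isCHomeo_of_locally_translation [CompleteSpace K] {d : ℕ} (t : ℝ≥0∞)
    {X : TopologicalSpace.Opens (Fin d → K)} {ψ : X ≃ₜ X}
    (h : ∀ a : X, ∃ c : Fin d → K, ∀ᶠ x in 𝓝 a, (ψ x : Fin d → K) = x + c) : IsCHomeo t X ψ := by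
  refine isCDiff_of_isRationalGerm t fun a ha i => ?_
  obtain ⟨c, hc⟩ := h ⟨a, ha⟩
  refine ((IsRationalGerm.linear (ContinuousLinearMap.proj i)).add
    (IsRationalGerm.const (c i))).congr ?_
  have h1 := (X.isOpen.isOpenEmbedding_subtypeVal.map_nhds_eq ⟨a, ha⟩)
  simp only at h1
  rw [← h1]
  refine hc.mono fun x hx => ?_
  have := Subtype.val_injective.extend_apply (fun x => (ψ x : Fin d → K)) 0 x
  simp only [Set.mem_ofPred_eq, this, hx]
  rfl

end RationalGerms

/-! ### Swaps of balls -/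

section Swap

variable {K : Type u} [NontriviallyNormedField K] [IsUltrametricDist K] {d : ℕ}

open scoped Classical in
/-- The map that interchanges the closed balls of radius `r` about `a` and `b` by translations. -/
noncomputable def swapFun (a b : Fin d → K) (r : ℝ) (x : Fin d → K) : Fin d → K :=
  if x ∈ Metric.closedBall a r then x + (b - a)
  else if x ∈ Metric.closedBall b r then x + (a - b) else x

variable {a b x y : Fin d → K} {r : ℝ}

theorem disjoint_closedBall_of_lt_dist (h : r < dist a b) :
    Disjoint (Metric.closedBall a r) (Metric.closedBall b r) := by
  rw [Set.disjoint_left]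
  intro x hx hx'
  rw [Metric.mem_closedBall] at hx hx'
  exact absurd ((dist_triangle_max a x b).trans (max_le (by rwa [dist_comm]) hx')) (not_le.2 h)

theorem swapFun_left (hx : x ∈ Metric.closedBall a r) : swapFun a b r x = x + (b - a) :=
  if_pos hx

theorem swapFun_right (h : r < dist a b) (hx : x ∈ Metric.closedBall b r) :
    swapFun a b r x = x + (a - b) := by
  rw [swapFun, if_neg (Set.disjoint_right.1 (disjoint_closedBall_of_lt_dist h) hx), if_pos hx]

theorem swapFun_off (ha : x ∉ Metric.closedBall a r) (hb : x ∉ Metric.closedBall b r) :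
    swapFun a b r x = x := by
  rw [swapFun, if_neg ha, if_neg hb]

theorem add_sub_mem_closedBall : x + (b - a) ∈ Metric.closedBall b r ↔ x ∈ Metric.closedBall a r := by
  simp only [Metric.mem_closedBall, dist_eq_norm]
  rw [show x + (b - a) - b = x - a by abel]

theorem swapFun_mem_right (hx : x ∈ Metric.closedBall a r) :
    swapFun a b r x ∈ Metric.closedBall b r := by
  rw [swapFun_left hx]; exact add_sub_mem_closedBall.2 hx

theorem swapFun_mem_left (h : r < dist a b) (hx : x ∈ Metric.closedBall b r) :
    swapFun a b r x ∈ Metric.closedBall a r := by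
  rw [swapFun_right h hx]; exact add_sub_mem_closedBall.2 hx

theorem swapFun_swapFun (h : r < dist a b) (x : Fin d → K) :
    swapFun a b r (swapFun a b r x) = x := by
  by_cases ha : x ∈ Metric.closedBall a r
  · rw [swapFun_right h (swapFun_mem_right ha), swapFun_left ha]; abel
  · by_cases hb : x ∈ Metric.closedBall b r
    · rw [swapFun_left (swapFun_mem_left h hb), swapFun_right h hb]; abel
    · rw [swapFun_off ha hb, swapFun_off ha hb]

/-- Closed balls of positive radius in an ultrametric space are clopen, so each of the three cases
of the definition holds on an open set. -/
theorem swapFun_locally_translation (hr : 0 < r) (h : r < dist a b) (x : Fin d → K) :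
    ∃ c : Fin d → K, ∀ᶠ y in 𝓝 x, swapFun a b r y = y + c := by
  have ho := fun c : Fin d → K => IsUltrametricDist.isClopen_closedBall c hr.ne'
  by_cases ha : x ∈ Metric.closedBall a r
  · exact ⟨b - a, Filter.mem_of_superset ((ho a).2.mem_nhds ha) fun y => swapFun_left⟩
  · by_cases hb : x ∈ Metric.closedBall b r
    · exact ⟨a - b, Filter.mem_of_superset ((ho b).2.mem_nhds hb) fun y => swapFun_right h⟩
    · refine ⟨0, ?_⟩
      filter_upwards [(ho a).1.isOpen_compl.mem_nhds ha, (ho b).1.isOpen_compl.mem_nhds hb]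
        with y h1 h2
      rw [swapFun_off h1 h2, add_zero]

theorem continuous_swapFun (hr : 0 < r) (h : r < dist a b) : Continuous (swapFun a b r) := by
  refine continuous_iff_continuousAt.2 fun x => ?_
  obtain ⟨c, hc⟩ := swapFun_locally_translation hr h x
  exact ((continuous_add_const c).continuousAt (x := x)).congr (hc.mono fun y hy => hy.symm)

/-- Points at distance at most `r` lie in the same closed balls of radius `r`, so both are
translated by the same vector. -/
theorem dist_swapFun_le (h : r < dist a b) (hxy : dist x y ≤ r) :
    dist (swapFun a b r x) (swapFun a b r y) ≤ r := by
  have key : ∀ c : Fin d → K, x ∈ Metric.closedBall c r ↔ y ∈ Metric.closedBall c r := by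
    have : ∀ c x y : Fin d → K, dist x y ≤ r → x ∈ Metric.closedBall c r →
        y ∈ Metric.closedBall c r := fun c x y hxy hx =>
      (dist_triangle_max y x c).trans (max_le (by rwa [dist_comm]) hx)
    exact fun c => ⟨this c x y hxy, this c y x (by rwa [dist_comm])⟩
  by_cases ha : x ∈ Metric.closedBall a r
  · rwa [swapFun_left ha, swapFun_left ((key a).1 ha), dist_add_right]
  · by_cases hb : x ∈ Metric.closedBall b r
    · rwa [swapFun_right h hb, swapFun_right h ((key b).1 hb), dist_add_right]
    · rwa [swapFun_off ha hb, swapFun_off (mt (key a).2 ha) (mt (key b).2 hb)]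

variable [ProperSpace K] [MeasurableSpace K] [BorelSpace K]

instance isAddHaarMeasure_unitBallHaar (d : ℕ) : (unitBallHaar K d).IsAddHaarMeasure := by
  unfold unitBallHaar; infer_instance

/-- Cut along the two balls: translation invariance exchanges the parts in the balls, and the rest
is unchanged. Only the balls have to be measurable, so `S` is arbitrary. -/
theorem measure_preimage_swapFun (h : r < dist a b) (S : Set (Fin d → K)) :
    unitBallHaar K d (swapFun a b r ⁻¹' S) = unitBallHaar K d S := by
  have hA : MeasurableSet (Metric.closedBall a r) := Metric.isClosed_closedBall.measurableSet
  have hB : MeasurableSet (Metric.closedBall b r) := Metric.isClosed_closedBall.measurableSet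
  have hAB := disjoint_closedBall_of_lt_dist h
  have split : ∀ T : Set (Fin d → K), unitBallHaar K d T =
      unitBallHaar K d (T ∩ Metric.closedBall a r) + (unitBallHaar K d (T ∩ Metric.closedBall b r) +
        unitBallHaar K d ((T \ Metric.closedBall a r) \ Metric.closedBall b r)) := by
    intro T
    rw [← measure_inter_add_sdiff T hA, ← measure_inter_add_sdiff (T \ Metric.closedBall a r) hB]
    congr 3
    ext x
    exact ⟨fun hx => ⟨hx.1.1, hx.2⟩, fun hx => ⟨⟨hx.1, Set.disjoint_right.1 hAB hx.2⟩, hx.2⟩⟩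
  have e1 : swapFun a b r ⁻¹' S ∩ Metric.closedBall a r =
      (fun x => x + (b - a)) ⁻¹' (S ∩ Metric.closedBall b r) := by
    ext x
    simp only [Set.mem_inter_iff, Set.mem_preimage, add_sub_mem_closedBall]
    exact and_congr_left fun hx => by rw [swapFun_left hx]
  have e2 : swapFun a b r ⁻¹' S ∩ Metric.closedBall b r =
      (fun x => x + (a - b)) ⁻¹' (S ∩ Metric.closedBall a r) := by
    ext x
    simp only [Set.mem_inter_iff, Set.mem_preimage, add_sub_mem_closedBall]
    exact and_congr_left fun hx => by rw [swapFun_right h hx]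
  have e3 : ((swapFun a b r ⁻¹' S) \ Metric.closedBall a r) \ Metric.closedBall b r =
      (S \ Metric.closedBall a r) \ Metric.closedBall b r := by
    ext x
    simp only [Set.mem_sdiff, Set.mem_preimage, and_assoc]
    exact and_congr_left fun hx => by rw [swapFun_off hx.1 hx.2]
  rw [split (swapFun a b r ⁻¹' S), split S, e1, e2, e3, measure_preimage_add_right,
    measure_preimage_add_right, add_left_comm]

end Swap

/-! ### Swaps as measure-preserving diffeomorphisms of `X` -/

section SwapHomeo

variable {K : Type u} [NontriviallyNormedField K] [IsUltrametricDist K] {d : ℕ}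
  {X : TopologicalSpace.Opens (Fin d → K)}

/-- The closed balls of radius `r > 0` about the points `a` and `b` of `X` are disjoint and contained
in `X`. -/
structure IsSwappable (X : TopologicalSpace.Opens (Fin d → K)) (a b : X) (r : ℝ) : Prop where
  pos : 0 < r
  lt_dist : r < dist a b
  left_subset : Metric.closedBall (a : Fin d → K) r ⊆ X
  right_subset : Metric.closedBall (b : Fin d → K) r ⊆ X

variable {a b : X} {r : ℝ}

theorem IsSwappable.swapFun_mem (h : IsSwappable X a b r) {x : Fin d → K} (hx : x ∈ X) :
    swapFun (a : Fin d → K) b r x ∈ X := by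
  by_cases ha : x ∈ Metric.closedBall (a : Fin d → K) r
  · exact h.right_subset (swapFun_mem_right ha)
  · by_cases hb : x ∈ Metric.closedBall (b : Fin d → K) r
    · exact h.left_subset (swapFun_mem_left h.lt_dist hb)
    · rwa [swapFun_off ha hb]

/-- The homeomorphism of `X` that interchanges two disjoint balls of the same radius. -/
noncomputable def IsSwappable.homeo (h : IsSwappable X a b r) : X ≃ₜ X where
  toFun x := ⟨swapFun (a : Fin d → K) b r x, h.swapFun_mem x.2⟩
  invFun x := ⟨swapFun (a : Fin d → K) b r x, h.swapFun_mem x.2⟩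
  left_inv _ := Subtype.ext (swapFun_swapFun h.lt_dist _)
  right_inv _ := Subtype.ext (swapFun_swapFun h.lt_dist _)
  continuous_toFun := ((continuous_swapFun h.pos h.lt_dist).comp continuous_subtype_val).subtype_mk _
  continuous_invFun := ((continuous_swapFun h.pos h.lt_dist).comp continuous_subtype_val).subtype_mk _

theorem IsSwappable.coe_homeo (h : IsSwappable X a b r) (x : X) :
    (h.homeo x : Fin d → K) = swapFun (a : Fin d → K) b r x := rfl

theorem IsSwappable.homeo_left (h : IsSwappable X a b r) {x : X} (hx : dist x a ≤ r) :
    dist (h.homeo x) b ≤ r :=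
  swapFun_mem_right (a := (a : Fin d → K)) (b := b) (x := x) hx

theorem IsSwappable.homeo_right (h : IsSwappable X a b r) {x : X} (hx : dist x b ≤ r) :
    dist (h.homeo x) a ≤ r :=
  swapFun_mem_left (a := (a : Fin d → K)) (b := b) (x := x) h.lt_dist hx

theorem IsSwappable.homeo_off (h : IsSwappable X a b r) {x : X} (ha : ¬ dist x a ≤ r)
    (hb : ¬ dist x b ≤ r) : h.homeo x = x :=
  Subtype.ext (swapFun_off ha hb)

theorem IsSwappable.dist_homeo_le (h : IsSwappable X a b r) {x y : X} (hxy : dist x y ≤ r) :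
    dist (h.homeo x) (h.homeo y) ≤ r :=
  dist_swapFun_le h.lt_dist hxy

variable [ProperSpace K]

theorem IsSwappable.homeo_mem_diffC (h : IsSwappable X a b r) (t : ℝ≥0∞) : h.homeo ∈ diffC t X := by
  have key : IsCHomeo t X h.homeo := by
    refine isCHomeo_of_locally_translation t fun x => ?_
    obtain ⟨c, hc⟩ := swapFun_locally_translation h.pos h.lt_dist (x : Fin d → K)
    exact ⟨c, continuous_subtype_val.continuousAt.eventually hc⟩
  -- A swap is an involution, and its inverse is given by the same function.
  exact ⟨key, key⟩

variable [MeasurableSpace K] [BorelSpace K]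

theorem openHaar_apply (X : TopologicalSpace.Opens (Fin d → K)) (S : Set X) :
    openHaar X S = unitBallHaar K d (Subtype.val '' S) :=
  (MeasurableEmbedding.subtype_coe X.isOpen.measurableSet).comap_apply _ _

theorem IsSwappable.map_homeo (h : IsSwappable X a b r) :
    (openHaar X).map h.homeo = openHaar X := by
  ext S hS
  rw [Measure.map_apply h.homeo.measurable hS, openHaar_apply, openHaar_apply]
  refine Eq.trans ?_ (measure_preimage_swapFun h.lt_dist _)
  congr 1
  ext x
  constructor
  · rintro ⟨y, hy, rfl⟩
    exact ⟨h.homeo y, hy, rfl⟩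
  · rintro ⟨y, hy, hyx⟩
    refine ⟨h.homeo y, ?_, ?_⟩
    · have : h.homeo (h.homeo y) = y := h.homeo.left_inv y
      rwa [Set.mem_preimage, this]
    · rw [h.coe_homeo, hyx, swapFun_swapFun h.lt_dist]

theorem IsSwappable.homeo_mem_diffCMeas (h : IsSwappable X a b r) (t : ℝ≥0∞) :
    h.homeo ∈ diffCMeas t X :=
  ⟨h.homeo_mem_diffC t, h.map_homeo⟩


end SwapHomeo

/-! ### The groups generated by swaps of balls -/

section SwapGroup

variable {K : Type u} [NontriviallyNormedField K] [IsUltrametricDist K] {d : ℕ}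
  {X : TopologicalSpace.Opens (Fin d → K)} {r : ℝ} {n : ℕ}

/-- The group generated by the swaps of disjoint closed balls of radius `r` contained in `X`. -/
def swapGroup (X : TopologicalSpace.Opens (Fin d → K)) (r : ℝ) : Subgroup (X ≃ₜ X) :=
  Subgroup.closure {ψ | ∃ a b, ∃ h : IsSwappable X a b r, ψ = h.homeo}

theorem IsSwappable.homeo_mem_swapGroup {a b : X} (h : IsSwappable X a b r) :
    h.homeo ∈ swapGroup X r :=
  Subgroup.subset_closure ⟨a, b, h, rfl⟩

/-- The group permutes the classes of the equivalence relation `dist x y ≤ r`, although its elements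
need not be isometries at larger distances. -/
theorem dist_apply_le_iff {g : X ≃ₜ X} (hg : g ∈ swapGroup X r) :
    ∀ x y : X, dist (g x) (g y) ≤ r ↔ dist x y ≤ r := by
  induction hg using Subgroup.closure_induction with
  | mem g hg =>
    obtain ⟨a, b, h, rfl⟩ := hg
    refine fun x y => ⟨fun hxy => ?_, h.dist_homeo_le⟩
    have := h.dist_homeo_le hxy
    have hinv : ∀ z, h.homeo (h.homeo z) = z := h.homeo.left_inv
    rwa [hinv, hinv] at this
  | one => exact fun x y => Iff.rfl
  | mul g g' _ _ h h' => exact fun x y => (h _ _).trans (h' _ _)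
  | inv g _ h =>
    intro x y
    rw [← h]
    simp

theorem closedBall_subset_of_dist_le {a b : X} (h : dist b a ≤ r)
    (ha : Metric.closedBall (a : Fin d → K) r ⊆ X) : Metric.closedBall (b : Fin d → K) r ⊆ X := by
  rwa [← IsUltrametricDist.closedBall_eq_of_mem (x := (a : Fin d → K)) (y := b) h]

/-- A swap either fixes a point or moves it between two balls contained in `X`. Hence a ball that
has already been moved can still be swapped. -/
theorem closedBall_apply_subset_iff {g : X ≃ₜ X} (hg : g ∈ swapGroup X r) :
    ∀ x : X, Metric.closedBall (g x : Fin d → K) r ⊆ X ↔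
      Metric.closedBall (x : Fin d → K) r ⊆ X := by
  induction hg using Subgroup.closure_induction with
  | mem g hg =>
    obtain ⟨a, b, h, rfl⟩ := hg
    intro x
    by_cases ha : dist x a ≤ r
    · exact iff_of_true (closedBall_subset_of_dist_le (h.homeo_left ha) h.right_subset)
        (closedBall_subset_of_dist_le ha h.left_subset)
    · by_cases hb : dist x b ≤ r
      · exact iff_of_true (closedBall_subset_of_dist_le (h.homeo_right hb) h.left_subset)
          (closedBall_subset_of_dist_le hb h.right_subset)
      · rw [h.homeo_off ha hb]
  | one => exact fun x => Iff.rfl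
  | mul g g' _ _ h h' => exact fun x => (h _).trans (h' _)
  | inv g _ h =>
    intro x
    rw [← h]
    simp

/-- The points `c₁, …, cₙ` of `X` are the centers of `n` disjoint closed balls of radius `r > 0`
contained in `X`. -/
structure IsBoxCenter (X : TopologicalSpace.Opens (Fin d → K)) (r : ℝ) (c : Fin n → X) : Prop where
  pos : 0 < r
  lt_dist : ∀ i j, i ≠ j → r < dist (c i) (c j)
  subset : ∀ i, Metric.closedBall (c i : Fin d → K) r ⊆ X

/-- The balls are put in place one at a time. Swapping the present position of the `i`-th ball with
its target leaves the balls already placed alone: they differ from the former because `g` permutes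
`r`-balls, and from the latter because the targets are disjoint. -/
theorem exists_swapGroup_forall_mem_dist_le {c c' : Fin n → X} (hc : IsBoxCenter X r c)
    (hc' : IsBoxCenter X r c') (I : Finset (Fin n)) :
    ∃ g ∈ swapGroup X r, ∀ i ∈ I, dist (g (c i)) (c' i) ≤ r := by
  induction I using Finset.induction_on with
  | empty => exact ⟨1, one_mem _, by simp⟩
  | insert i I hi ih =>
    obtain ⟨g, hg, hgI⟩ := ih
    by_cases h : dist (g (c i)) (c' i) ≤ r
    · refine ⟨g, hg, fun j hj => ?_⟩
      rcases Finset.mem_insert.1 hj with rfl | hj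
      exacts [h, hgI j hj]
    · have hs : IsSwappable X (g (c i)) (c' i) r :=
        ⟨hc.pos, not_le.1 h, (closedBall_apply_subset_iff hg _).2 (hc.subset i), hc'.subset i⟩
      refine ⟨hs.homeo * g, mul_mem hs.homeo_mem_swapGroup hg, fun j hj => ?_⟩
      change dist (hs.homeo (g (c j))) (c' j) ≤ r
      rcases Finset.mem_insert.1 hj with rfl | hj
      · exact hs.homeo_left (by simpa using hc.pos.le)
      · have hij : j ≠ i := fun hji => hi (hji ▸ hj)
        rw [hs.homeo_off]
        · exact hgI j hj
        · rw [dist_apply_le_iff hg]; exact not_le.2 (hc.lt_dist j i hij)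
        · intro h'
          refine not_le.2 (hc'.lt_dist j i hij) ?_
          exact (dist_triangle_max _ (g (c j)) _).trans (max_le (by rw [dist_comm]; exact hgI j hj) h')

/-- Any box of radius `r` can be moved to any other. -/
theorem exists_swapGroup_forall_dist_le {c c' : Fin n → X} (hc : IsBoxCenter X r c)
    (hc' : IsBoxCenter X r c') : ∃ g ∈ swapGroup X r, ∀ i, dist (g (c i)) (c' i) ≤ r := by
  obtain ⟨g, hg, h⟩ := exists_swapGroup_forall_mem_dist_le hc hc' Finset.univ
  exact ⟨g, hg, fun i => h i (Finset.mem_univ i)⟩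

/-! ### Measure invariance, and moving a ball out of a compact set -/

variable [ProperSpace K]

theorem isCompact_closedBall_of_subset {a : X} (ha : Metric.closedBall (a : Fin d → K) r ⊆ X) :
    IsCompact (Metric.closedBall a r) := by
  rw [Subtype.isCompact_iff]
  have : Subtype.val '' Metric.closedBall a r = Metric.closedBall (a : Fin d → K) r := by
    ext x
    exact ⟨by rintro ⟨y, hy, rfl⟩; exact hy, fun hx => ⟨⟨x, ha hx⟩, hx, rfl⟩⟩
  rw [this]
  exact isCompact_closedBall _ _

variable [MeasurableSpace K] [BorelSpace K]

theorem map_openHaar_of_mem_swapGroup {g : X ≃ₜ X} (hg : g ∈ swapGroup X r) :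
    (openHaar X).map g = openHaar X := by
  induction hg using Subgroup.closure_induction with
  | mem g hg =>
    obtain ⟨a, b, h, rfl⟩ := hg
    exact h.map_homeo
  | one => exact Measure.map_id
  | mul g g' _ _ h h' =>
    rw [show ((g * g' : X ≃ₜ X) : X → X) = g ∘ g' from rfl,
      ← Measure.map_map g.measurable g'.measurable, h', h]
  | inv g _ h =>
    conv_lhs => rw [← h]
    rw [Measure.map_map (g⁻¹).measurable g.measurable]
    have : (g⁻¹ : X ≃ₜ X) ∘ g = id := by ext1 x; simp
    rw [this, Measure.map_id]

instance isFiniteMeasureOnCompacts_openHaar (X : TopologicalSpace.Opens (Fin d → K)) :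
    IsFiniteMeasureOnCompacts (openHaar X) :=
  ⟨fun S hS => by
    rw [openHaar_apply]
    exact (hS.image continuous_subtype_val).measure_lt_top⟩

instance isOpenPosMeasure_openHaar (X : TopologicalSpace.Opens (Fin d → K)) :
    (openHaar X).IsOpenPosMeasure :=
  ⟨fun U hU hne => by
    rw [openHaar_apply]
    exact (X.isOpen.isOpenMap_subtype_val U hU).measure_ne_zero _ (hne.image _)⟩

/-- If the measure of `X` is infinite, then a ball can be moved away from a compact set `Y`
containing it without moving the other points of `Y`. -/
theorem exists_swapGroup_move_off (hX : openHaar X Set.univ = ∞) {a : X} (hr : 0 < r)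
    (ha : Metric.closedBall (a : Fin d → K) r ⊆ X) {Y : Set X} (hY : IsCompact Y)
    (haY : Metric.closedBall a r ⊆ Y) :
    ∃ ρ, ∃ g ∈ swapGroup X ρ, (∀ x ∈ Y, ¬ dist x a ≤ r → g x = x) ∧
      ∀ x, dist x a ≤ r → g x ∉ Y := by
  classical
  -- The complement of `Y` need not contain a ball of radius `r`. The centers of balls of radius `ρ
  -- k` inside the complement form sets `U k` increasing to it, so some `U k` has larger measure
  -- than the ball about `a`, and swaps of that smaller radius are used.
  let ρ : ℕ → ℝ := fun k => min r (1 / ((k : ℝ) + 1))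
  let U : ℕ → Set X := fun k => {x | Metric.closedBall (x : Fin d → K) (ρ k) ⊆ Subtype.val '' Yᶜ}
  have hUmono : Monotone U := by
    intro k l hkl x hx
    refine (Metric.closedBall_subset_closedBall ?_).trans hx
    refine min_le_min le_rfl (one_div_le_one_div_of_le (by positivity) ?_)
    exact_mod_cast Nat.succ_le_succ hkl
  have hO : IsOpen (Subtype.val '' Yᶜ : Set (Fin d → K)) :=
    X.isOpen.isOpenMap_subtype_val _ hY.isClosed.isOpen_compl
  have hUunion : Yᶜ ⊆ ⋃ k, U k := by
    intro x hx
    obtain ⟨ε, hε, hb⟩ := Metric.isOpen_iff.1 hO x ⟨x, hx, rfl⟩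
    obtain ⟨k, hk⟩ := exists_nat_one_div_lt hε
    refine Set.mem_iUnion.2 ⟨k, (Metric.closedBall_subset_ball ?_).trans hb⟩
    exact (min_le_right _ _).trans_lt hk
  have hYc : openHaar X Yᶜ = ∞ := by
    have h1 := measure_add_measure_compl (μ := openHaar X) hY.isClosed.measurableSet
    rw [hX] at h1
    exact (ENNReal.add_eq_top.1 h1).resolve_left hY.measure_lt_top.ne
  obtain ⟨k, hk⟩ : ∃ k, openHaar X (Metric.closedBall a r) < openHaar X (U k) := by
    have h1 : openHaar X (⋃ k, U k) = ∞ := top_le_iff.1 (hYc ▸ measure_mono hUunion)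
    rw [hUmono.measure_iUnion] at h1
    exact lt_iSup_iff.1 (h1 ▸ (isCompact_closedBall_of_subset ha).measure_lt_top)
  have hρ0 : 0 < ρ k := lt_min hr (by positivity)
  have hρr : ρ k ≤ r := min_le_left _ _
  have hUY : ∀ e ∈ U k, ∀ x : X, dist x e ≤ ρ k → x ∉ Y := by
    intro e he x hx
    obtain ⟨y, hy, hyx⟩ := he (show (x : Fin d → K) ∈ Metric.closedBall (e : Fin d → K) (ρ k) from hx)
    rwa [← Subtype.val_injective hyx]
  have hsub : ∀ e : X, dist e a ≤ r → ∀ x : X, dist x e ≤ ρ k → dist x a ≤ r := fun e he x hx =>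
    (dist_triangle_max x e a).trans (max_le (hx.trans hρr) he)
  -- Small balls about the points of `T` are sent off `Y` one after the other; the last clause, that
  -- the rest of the large ball has not moved yet, allows the next swap.
  have key : ∀ T : Finset X, (∀ x ∈ T, dist x a ≤ r) → ∃ g ∈ swapGroup X (ρ k),
      (∀ x ∈ Y, ¬ dist x a ≤ r → g x = x) ∧
      (∀ x, dist x a ≤ r → (∃ e ∈ T, dist x e ≤ ρ k) → g x ∉ Y) ∧
      ∀ x, dist x a ≤ r → (∀ e ∈ T, ¬ dist x e ≤ ρ k) → g x = x := by
    intro T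
    induction T using Finset.induction_on with
    | empty => exact fun _ => ⟨1, one_mem _, by simp, by simp, by simp⟩
    | insert e T heT ih =>
      intro hT
      have hea : dist e a ≤ r := hT e (Finset.mem_insert_self _ _)
      obtain ⟨g, hg, h1, h2, h3⟩ := ih fun x hx => hT x (Finset.mem_insert_of_mem hx)
      by_cases hnear : ∃ e' ∈ T, dist e e' ≤ ρ k
      · refine ⟨g, hg, h1, fun x hx hxT => h2 x hx ?_, fun x hx hxT =>
          h3 x hx fun e' he' => hxT e' (Finset.mem_insert_of_mem he')⟩
        obtain ⟨e', he', hxe'⟩ := hxT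
        rcases Finset.mem_insert.1 he' with rfl | he'
        · obtain ⟨e'', he'', h⟩ := hnear
          exact ⟨e'', he'', (dist_triangle_max x e' e'').trans (max_le hxe' h)⟩
        · exact ⟨e', he', hxe'⟩
      · push Not at hnear
        have hge : g e = e := h3 e hea fun e' he' => not_le.2 (hnear e' he')
        -- The image of the large ball under `g` has the measure of that ball, which is less than
        -- that of `U k`, so there is a free target center `f` outside this image.
        obtain ⟨f, hfU, hf⟩ : ∃ f ∈ U k, f ∉ (g⁻¹ : X ≃ₜ X) ⁻¹' Metric.closedBall a r := by
          by_contra hcon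
          push Not at hcon
          refine not_le.2 hk ((measure_mono hcon).trans_eq ?_)
          rw [← Measure.map_apply (g⁻¹).measurable Metric.isClosed_closedBall.measurableSet,
            map_openHaar_of_mem_swapGroup (inv_mem hg)]
        have hfar : ∀ x, dist x a ≤ r → ¬ dist (g x) f ≤ ρ k := by
          intro x hx hxf
          refine hf (hsub x hx _ ?_)
          rw [← dist_apply_le_iff hg]
          simpa [dist_comm] using hxf
        have hs : IsSwappable X e f (ρ k) :=
          ⟨hρ0, by have := hfar e hea; rwa [hge, not_le] at this,
            (Metric.closedBall_subset_closedBall hρr).trans (closedBall_subset_of_dist_le hea ha),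
            fun x hx => by obtain ⟨y, -, rfl⟩ := hfU hx; exact y.2⟩
        refine ⟨hs.homeo * g, mul_mem hs.homeo_mem_swapGroup hg, ?_, ?_, ?_⟩
        · intro x hxY hxa
          change hs.homeo (g x) = x
          rw [h1 x hxY hxa]
          exact hs.homeo_off (fun h => hxa (hsub e hea x h)) fun h => hUY f hfU x h hxY
        · intro x hx hxT
          change hs.homeo (g x) ∉ Y
          by_cases hxT' : ∃ e' ∈ T, dist x e' ≤ ρ k
          · have := h2 x hx hxT'
            rwa [hs.homeo_off (fun h => this (haY (hsub e hea _ h))) (hfar x hx)]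
          · obtain ⟨e', he', hxe'⟩ := hxT
            rcases Finset.mem_insert.1 he' with rfl | he'
            · push Not at hxT'
              rw [h3 x hx fun e' he' => not_le.2 (hxT' e' he')]
              exact hUY f hfU _ (hs.homeo_left hxe')
            · exact absurd ⟨e', he', hxe'⟩ hxT'
        · intro x hx hxT
          change hs.homeo (g x) = x
          have hgx := h3 x hx fun e' he' => hxT e' (Finset.mem_insert_of_mem he')
          have hxf := hfar x hx
          rw [hgx] at hxf ⊢
          exact hs.homeo_off (hxT e (Finset.mem_insert_self _ _)) hxf
  obtain ⟨T, hTa, hTfin, hTcov⟩ := (isCompact_closedBall_of_subset ha).finite_cover_balls hρ0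
  obtain ⟨g, hg, h1, h2, -⟩ := key hTfin.toFinset fun x hx => hTa (hTfin.mem_toFinset.1 hx)
  refine ⟨ρ k, g, hg, h1, fun x hx => h2 x hx ?_⟩
  obtain ⟨e, he, hxe⟩ := Set.mem_iUnion₂.1 (hTcov hx)
  exact ⟨e, hTfin.mem_toFinset.2 he, (Metric.mem_ball.1 hxe).le⟩

end SwapGroup

/-! ### Vectors attached to sets of tuples -/

section BoxVec

variable {X : Type v} [MeasurableSpace X] {n : ℕ} {W : Type w} [NormedAddCommGroup W]
  [InnerProductSpace ℂ W] {m : Measure X}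

/-- The enumeration of `n`-point subsets that results from a cross-section by a permutation. -/
def MeasurableSection.enum (s : MeasurableSection X n) (κ : Equiv.Perm (Fin n))
    (γ : Set.powersetCard X n) : Fin n → X :=
  fun i => (s.toFun γ).1 (κ i)

theorem MeasurableSection.measurable_enum (s : MeasurableSection X n) (κ : Equiv.Perm (Fin n)) :
    Measurable (s.enum κ) :=
  measurable_pi_lambda _ fun i =>
    (measurable_pi_apply (κ i)).comp (measurable_subtype_coe.comp s.measurable_toFun)

theorem MeasurableSection.forall_enum (s : MeasurableSection X n) (κ : Equiv.Perm (Fin n))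
    (γ : Set.powersetCard X n) (p : X → Prop) :
    (∀ i, p (s.enum κ γ i)) ↔ ∀ i, p ((s.toFun γ).1 i) :=
  ⟨fun h i => by simpa [enum] using h (κ.symm i), fun h i => h (κ i)⟩

variable (s : MeasurableSection X n) (q : Equiv.Perm (Fin n) →* (W ≃ₗᵢ[ℂ] W))

/-- The function `γ ↦ ∑ q(κ) w` on `n`-point subsets, where `κ` runs through the permutations for
which the enumeration `s(γ) κ` belongs to `S`. -/
noncomputable def boxFun (S : Set (Fin n → X)) (w : W) (γ : Set.powersetCard X n) : W :=
  ∑ κ, (s.enum κ ⁻¹' S).indicator (fun _ => q κ w) γ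

theorem boxFun_eq_zero {S : Set (Fin n → X)} {w : W} {γ : Set.powersetCard X n}
    (h : ∀ κ, s.enum κ γ ∉ S) : boxFun s q S w γ = 0 :=
  Finset.sum_eq_zero fun κ _ => Set.indicator_of_notMem (s := s.enum κ ⁻¹' S) (h κ) _

/-- Substituting `κ' ↦ κ' κ` in the sum trades a reordering of the coordinates for the action of `q`
on `w`. -/
theorem boxFun_perm (S : Set (Fin n → X)) (κ : Equiv.Perm (Fin n)) (w : W) :
    boxFun s q {x | (fun i => x (κ i)) ∈ S} w = boxFun s q S (q κ⁻¹ w) := by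
  ext1 γ
  refine Fintype.sum_equiv (Equiv.mulRight κ) _ _ fun κ' => ?_
  have : q (κ' * κ) (q κ⁻¹ w) = q κ' w := by
    rw [map_mul, map_inv]
    exact congrArg (q κ') ((q κ).apply_symm_apply w)
  simp only [Equiv.coe_mulRight, this]
  rfl

theorem boxFun_biUnion {ι : Type*} (T : Finset ι) (S : ι → Set (Fin n → X))
    (hd : (T : Set ι).PairwiseDisjoint S) (w : W) :
    boxFun s q (⋃ i ∈ T, S i) w = ∑ i ∈ T, boxFun s q (S i) w := by
  ext1 γ
  simp only [boxFun, Finset.sum_apply]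
  rw [Finset.sum_comm]
  refine Finset.sum_congr rfl fun κ _ => ?_
  simp only [Set.preimage_iUnion]
  rw [Finset.indicator_biUnion_apply]
  exact fun i hi j hj hij => (hd hi hj hij).preimage _

/-- If exactly one enumeration belongs to `S`, the function is `q(κ) w` for that enumeration. -/
theorem boxFun_eq_of_mem {S : Set (Fin n → X)} {w : W} {γ : Set.powersetCard X n}
    {κ : Equiv.Perm (Fin n)} (hκ : s.enum κ γ ∈ S) (h : ∀ κ', s.enum κ' γ ∈ S → κ' = κ) :
    boxFun s q S w γ = q κ w := by
  rw [boxFun, Finset.sum_eq_single κ]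
  · exact Set.indicator_of_mem (s := s.enum κ ⁻¹' S) hκ _
  · exact fun κ' _ hκ' => Set.indicator_of_notMem (s := s.enum κ' ⁻¹' S)
      (fun h' => hκ' (h κ' h')) _
  · simp

variable [TopologicalSpace X]

/-- A measurable set of tuples whose components lie in a common compact set. -/
structure IsBoundedMeasurable (S : Set (Fin n → X)) : Prop where
  measurableSet : MeasurableSet S
  exists_isCompact : ∃ Y : Set X, IsCompact Y ∧ ∀ x ∈ S, ∀ i, x i ∈ Y

variable [BorelSpace X]

/-- By the definition of `sigma`, the enumeration of `ψ⁻¹(γ)` by `κ` is `ψ⁻¹` applied to that of `γ`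
by `σ κ`. The substitution `κ ↦ σ κ` thus absorbs the twist by `q`, and only the set moves. -/
theorem vFun_boxFun_eq (ψ : X ≃ₜ X) (S : Set (Fin n → X)) (w : W) (γ : Set.powersetCard X n) :
    q (sigma s ψ γ) (boxFun s q S w (confMap ψ⁻¹ γ)) =
      boxFun s q {x | (fun i => ψ⁻¹ (x i)) ∈ S} w γ := by
  rw [boxFun, map_sum, boxFun]
  refine Fintype.sum_equiv (Equiv.mulLeft (sigma s ψ γ)) _ _ fun κ => ?_
  have he : s.enum κ (confMap ψ⁻¹ γ) = fun i => ψ⁻¹ (s.enum (sigma s ψ γ * κ) γ i) := by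
    ext1 i; exact sigma_spec s ψ γ (κ i)
  simp only [Equiv.coe_mulLeft]
  by_cases h : s.enum κ (confMap ψ⁻¹ γ) ∈ S
  · rw [Set.indicator_of_mem (show confMap ψ⁻¹ γ ∈ s.enum κ ⁻¹' S from h), Set.indicator_of_mem]
    · simp [map_mul]
    · rw [he] at h; exact h
  · rw [Set.indicator_of_notMem (show confMap ψ⁻¹ γ ∉ s.enum κ ⁻¹' S from h),
      Set.indicator_of_notMem, map_zero]
    rw [he] at h; exact h

variable [SecondCountableTopology X] [T2Space X] [SigmaFinite m]

theorem confMeasure_apply {E : Set (Set.powersetCard X n)} (hE : MeasurableSet E) :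
    confMeasure m n E =
      Measure.pi (fun _ => m) ((Subtype.val : DistinctTuple X n → Fin n → X) '' (toSubset ⁻¹' E)) := by
  rw [confMeasure, Measure.map_apply measurable_toSubset hE,
    measurableEmbedding_distinctTuple.comap_apply]

theorem MeasurableSection.exists_enum_toSubset (x : DistinctTuple X n) (κ : Equiv.Perm (Fin n)) :
    ∃ κ' : Equiv.Perm (Fin n), s.enum κ' (toSubset x) = fun i => x.1 (κ i) := by
  have h : ∀ i, ∃ j, (s.toFun (toSubset x)).1 j = x.1 (κ i) := fun i => by
    rw [← mem_toSubset, s.toSubset_toFun, mem_toSubset]; exact ⟨_, rfl⟩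
  choose j hj using h
  have hinj : Function.Injective j := fun a b hab =>
    κ.injective (x.2 (by rw [← hj, ← hj, hab]))
  exact ⟨Equiv.ofBijective j (Finite.injective_iff_bijective.1 hinj), funext hj⟩

variable [IsFiniteMeasureOnCompacts m]

/-- If one enumeration has all components in `Y`, then all enumerations do, so the measure is at
most `m(Y) ^ n`. -/
theorem IsBoundedMeasurable.confMeasure_lt_top {S : Set (Fin n → X)} (hS : IsBoundedMeasurable S)
    (κ : Equiv.Perm (Fin n)) : confMeasure m n (s.enum κ ⁻¹' S) < ∞ := by
  obtain ⟨Y, hY, hSY⟩ := hS.exists_isCompact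
  rw [confMeasure_apply (s.measurable_enum κ hS.measurableSet)]
  refine lt_of_le_of_lt (measure_mono (t := Set.pi Set.univ fun _ => Y) ?_) ?_
  · rintro _ ⟨x, hx, rfl⟩ i -
    have h1 : ∀ i, (s.toFun (toSubset x)).1 i ∈ Y :=
      (s.forall_enum κ _ (· ∈ Y)).1 (hSY _ hx)
    have h2 : x.1 i ∈ (toSubset (s.toFun (toSubset x)) : Finset X) := by
      rw [s.toSubset_toFun, mem_toSubset]; exact ⟨i, rfl⟩
    obtain ⟨j, hj⟩ := mem_toSubset.1 h2
    exact hj ▸ h1 j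
  · rw [Measure.pi_pi]
    exact ENNReal.prod_lt_top fun _ _ => hY.measure_lt_top

theorem memLp_boxFun {S : Set (Fin n → X)} (hS : IsBoundedMeasurable S) (w : W) :
    MemLp (boxFun s q S w) 2 (confMeasure m n) := by
  have : boxFun s q S w = fun γ => ∑ κ, (s.enum κ ⁻¹' S).indicator (fun _ => q κ w) γ := rfl
  rw [this]
  exact memLp_finsetSum _ fun κ _ => memLp_indicator_const 2
    (s.measurable_enum κ hS.measurableSet) _ (Or.inr (hS.confMeasure_lt_top s κ).ne)

open scoped Classical in
/-- The element of `L²` given by the function `boxFun` (and `0` if it is not square integrable). -/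
noncomputable def boxVec (m : Measure X) (s : MeasurableSection X n)
    (q : Equiv.Perm (Fin n) →* (W ≃ₗᵢ[ℂ] W)) (S : Set (Fin n → X)) (w : W) :
    Lp W 2 (confMeasure m n) :=
  if h : MemLp (boxFun s q S w) 2 (confMeasure m n) then h.toLp else 0

theorem coeFn_boxVec {S : Set (Fin n → X)} (hS : IsBoundedMeasurable S) (w : W) :
    boxVec m s q S w =ᵐ[confMeasure m n] boxFun s q S w := by
  rw [boxVec, dif_pos (memLp_boxFun s q hS w)]
  exact MemLp.coeFn_toLp _

theorem boxVec_perm (S : Set (Fin n → X)) (κ : Equiv.Perm (Fin n)) (w : W) :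
    boxVec m s q {x | (fun i => x (κ i)) ∈ S} w = boxVec m s q S (q κ⁻¹ w) := by
  have h := boxFun_perm s q S κ w
  unfold boxVec
  generalize boxFun s q {x | (fun i => x (κ i)) ∈ S} w = f at h ⊢
  subst h
  rfl

theorem boxVec_biUnion {ι : Type*} (T : Finset ι) (S : ι → Set (Fin n → X))
    (hS : ∀ i ∈ T, IsBoundedMeasurable (S i)) (hT : IsBoundedMeasurable (⋃ i ∈ T, S i))
    (hd : (T : Set ι).PairwiseDisjoint S) (w : W) :
    boxVec m s q (⋃ i ∈ T, S i) w = ∑ i ∈ T, boxVec m s q (S i) w := by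
  have h : ∀ i ∈ T, MemLp (boxFun s q (S i) w) 2 (confMeasure m n) := fun i hi =>
    memLp_boxFun s q (hS i hi) w
  apply Lp.ext
  refine (coeFn_boxVec s q hT w).trans ?_
  rw [boxFun_biUnion s q T S hd]
  filter_upwards [Lp.coeFn_finsetSum T fun i => boxVec m s q (S i) w,
    (Filter.eventually_all_finset T).2 fun i hi => coeFn_boxVec s q (hS i hi) w] with γ h1 h2
  rw [h1, Finset.sum_apply, Finset.sum_apply]
  exact Finset.sum_congr rfl fun i hi => (h2 i hi).symm

/-- For bounded measurable `S`, the vector attached to `S` and `w` depends linearly on `w`. -/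
noncomputable def boxLin (m : Measure X) [SigmaFinite m] [IsFiniteMeasureOnCompacts m]
    (s : MeasurableSection X n) (q : Equiv.Perm (Fin n) →* (W ≃ₗᵢ[ℂ] W)) {S : Set (Fin n → X)}
    (hS : IsBoundedMeasurable S) : W →ₗ[ℂ] Lp W 2 (confMeasure m n) where
  toFun := boxVec m s q S
  map_add' w w' := by
    apply Lp.ext
    filter_upwards [coeFn_boxVec s q hS w, coeFn_boxVec s q hS w', coeFn_boxVec s q hS (w + w'),
      Lp.coeFn_add (boxVec m s q S w) (boxVec m s q S w')] with γ h1 h2 h3 h4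
    rw [h3, h4, Pi.add_apply, h1, h2]
    simp only [boxFun, ← Finset.sum_add_distrib, map_add]
    exact Finset.sum_congr rfl fun κ _ => congrFun (Set.indicator_add _ _ _) γ
  map_smul' c w := by
    apply Lp.ext
    filter_upwards [coeFn_boxVec s q hS w, coeFn_boxVec s q hS (c • w),
      Lp.coeFn_smul c (boxVec m s q S w)] with γ h1 h2 h3
    rw [RingHom.id_apply, h2, h3, Pi.smul_apply, h1]
    simp only [boxFun, Finset.smul_sum, map_smul]
    exact Finset.sum_congr rfl fun κ _ => Set.indicator_const_smul_apply _ _ _ _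

theorem boxLin_apply {S : Set (Fin n → X)} (hS : IsBoundedMeasurable S) (w : W) :
    boxLin m s q hS w = boxVec m s q S w := rfl

theorem IsBoundedMeasurable.preimage {S : Set (Fin n → X)} (hS : IsBoundedMeasurable S)
    (ψ : X ≃ₜ X) : IsBoundedMeasurable {x : Fin n → X | (fun i => ψ⁻¹ (x i)) ∈ S} := by
  obtain ⟨Y, hY, hSY⟩ := hS.exists_isCompact
  refine ⟨?_, ψ '' Y, hY.image ψ.continuous, fun x hx i => ⟨ψ⁻¹ (x i), hSY _ hx i, by simp⟩⟩
  exact (measurable_pi_lambda _ fun i => (ψ⁻¹).measurable.comp (measurable_pi_apply i))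
    hS.measurableSet

/-- For measure-preserving `ψ` the density is `1` almost everywhere, and `vFun_boxFun_eq` handles
the rest. -/
theorem repV_boxVec {ψ : X ≃ₜ X} (hψ : m.map ψ = m) {S : Set (Fin n → X)}
    (hS : IsBoundedMeasurable S) (w : W) :
    repV m s q ⟨ψ, mem_quasiInvGroup_of_map_eq hψ⟩ (boxVec m s q S w) =
      boxVec m s q {x | (fun i => ψ⁻¹ (x i)) ∈ S} w := by
  have := confMeasure_sigmaFinite m n
  have hρ : (rho m ψ : Set.powersetCard X n → ℝ≥0∞) =ᵐ[confMeasure m n] 1 := by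
    change ((confMeasure m n).map (confMap ψ)).rnDeriv (confMeasure m n) =ᵐ[_] _
    rw [map_confMeasure_of_map_eq hψ]
    exact Measure.rnDeriv_self _
  apply Lp.ext
  refine (coeFn_vLin s q (mem_quasiInvGroup_of_map_eq hψ) _).trans ?_
  refine (vFun_congr s q (mem_quasiInvGroup_of_map_eq hψ) (coeFn_boxVec s q hS w)).trans ?_
  filter_upwards [hρ, coeFn_boxVec s q (hS.preimage ψ) w] with γ h1 h2
  rw [h2, vFun, h1, ← vFun_boxFun_eq]
  simp

/-- The supports are disjoint: subsets with an enumeration in `S` are contained in `Y`, those with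
one in `S'` are not. -/
theorem inner_boxVec_eq_zero {S S' : Set (Fin n → X)} (hS : IsBoundedMeasurable S)
    (hS' : IsBoundedMeasurable S') {Y : Set X} (hY : ∀ x ∈ S, ∀ i, x i ∈ Y) {j : Fin n}
    (hj : ∀ x ∈ S', x j ∉ Y) (w w' : W) :
    inner ℂ (boxVec m s q S w) (boxVec m s q S' w') = 0 := by
  rw [L2.inner_def]
  refine integral_eq_zero_of_ae ?_
  filter_upwards [coeFn_boxVec s q hS w, coeFn_boxVec s q hS' w'] with γ h1 h2
  rw [h1, h2, Pi.zero_apply]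
  by_cases h : ∃ κ, s.enum κ γ ∈ S
  · obtain ⟨κ, hκ⟩ := h
    rw [boxFun_eq_zero s q (S := S') fun κ' hκ' => hj _ hκ' ?_, inner_zero_right]
    exact (s.forall_enum κ γ (· ∈ Y)).1 (hY _ hκ) (κ' j)
  · push Not at h
    rw [boxFun_eq_zero s q h, inner_zero_left]

end BoxVec

/-! ### Density of the vectors attached to boxes -/

section Boxes

variable {K : Type u} [NontriviallyNormedField K] [IsUltrametricDist K] {d : ℕ}
  {X : TopologicalSpace.Opens (Fin d → K)} {r r' : ℝ} {n : ℕ} {c c' : Fin n → X}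

theorem IsBoxCenter.of_mem_closedBall (hc : IsBoxCenter X r c) (hr' : 0 < r') (h : r' ≤ r)
    (hcc : c' ∈ Metric.closedBall c r) : IsBoxCenter X r' c' := by
  have hd : ∀ i, dist (c' i) (c i) ≤ r := (dist_pi_le_iff hc.pos.le).1 hcc
  refine ⟨hr', fun i j hij => h.trans_lt ?_, fun i => ?_⟩
  · by_contra hlt
    refine not_le.2 (hc.lt_dist i j hij) ((dist_triangle_max _ (c' i) _).trans (max_le ?_ ?_))
    · rw [dist_comm]; exact hd i
    · exact (dist_triangle_max _ (c' j) _).trans (max_le (not_lt.1 hlt) (hd j))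
  · exact (Metric.closedBall_subset_closedBall h).trans
      (closedBall_subset_of_dist_le (hd i) (hc.subset i))

theorem IsBoxCenter.eventually {x : Fin n → X} (hx : Function.Injective x) :
    ∀ᶠ r in 𝓝[>] (0 : ℝ), IsBoxCenter X r x := by
  have h1 : ∀ᶠ r in 𝓝[>] (0 : ℝ), ∀ i j, i ≠ j → r < dist (x i) (x j) := by
    refine eventually_all.2 fun i => eventually_all.2 fun j => ?_
    by_cases hij : i = j
    · exact Eventually.of_forall fun _ h => absurd hij h
    · exact (eventually_nhdsWithin_of_eventually_nhds
        (Iio_mem_nhds (dist_pos.2 (hx.ne hij)))).mono fun _ h _ => h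
  have h2 : ∀ᶠ r in 𝓝[>] (0 : ℝ), ∀ i, Metric.closedBall (x i : Fin d → K) r ⊆ X := by
    refine eventually_all.2 fun i => ?_
    obtain ⟨ε, hε, hb⟩ := Metric.isOpen_iff.1 X.isOpen (x i) (x i).2
    exact (eventually_nhdsWithin_of_eventually_nhds (Iio_mem_nhds hε)).mono fun r hr =>
      (Metric.closedBall_subset_ball hr).trans hb
  filter_upwards [h1, h2, self_mem_nhdsWithin] with r h1 h2 h3
  exact ⟨h3, h1, h2⟩

variable [ProperSpace K]

theorem IsBoxCenter.isCompact_closedBall (hc : IsBoxCenter X r c) :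
    IsCompact (Metric.closedBall c r) := by
  rw [closedBall_pi _ hc.pos.le]
  exact isCompact_univ_pi fun i => isCompact_closedBall_of_subset (hc.subset i)

theorem IsBoxCenter.isCompact_iUnion (hc : IsBoxCenter X r c) :
    IsCompact (⋃ i, Metric.closedBall (c i) r) :=
  _root_.isCompact_iUnion fun i => isCompact_closedBall_of_subset (hc.subset i)

theorem IsBoxCenter.mem_iUnion (hc : IsBoxCenter X r c) {x : Fin n → X}
    (hx : x ∈ Metric.closedBall c r) (i : Fin n) : x i ∈ ⋃ i, Metric.closedBall (c i) r :=
  Set.mem_iUnion.2 ⟨i, (dist_pi_le_iff hc.pos.le).1 hx i⟩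

variable [MeasurableSpace K] [BorelSpace K]

theorem IsBoxCenter.isBoundedMeasurable (hc : IsBoxCenter X r c) :
    IsBoundedMeasurable (Metric.closedBall c r) :=
  ⟨Metric.isClosed_closedBall.measurableSet, _, hc.isCompact_iUnion, fun _ hx => hc.mem_iUnion hx⟩

theorem IsBoundedMeasurable.inter_left {S S' : Set (Fin n → X)} (hS : IsBoundedMeasurable S)
    (hS' : MeasurableSet S') : IsBoundedMeasurable (S' ∩ S) := by
  obtain ⟨Y, hY, hSY⟩ := hS.exists_isCompact
  exact ⟨hS'.inter hS.measurableSet, Y, hY, fun x hx => hSY x hx.2⟩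

/-- At most one enumeration of an `n`-point subset belongs to a given box. -/
theorem IsBoxCenter.enum_unique (s : MeasurableSection X n) (hc : IsBoxCenter X r c)
    {γ : Set.powersetCard X n} {κ κ' : Equiv.Perm (Fin n)}
    (h : s.enum κ γ ∈ Metric.closedBall c r) (h' : s.enum κ' γ ∈ Metric.closedBall c r) :
    κ' = κ := by
  ext1 i
  have h1 : dist (s.enum κ' γ i) (c i) ≤ r := (dist_pi_le_iff hc.pos.le).1 h' i
  have h2 : dist (s.enum κ γ (κ.symm (κ' i))) (c (κ.symm (κ' i))) ≤ r :=
    (dist_pi_le_iff hc.pos.le).1 h _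
  simp only [MeasurableSection.enum, Equiv.apply_symm_apply] at h1 h2
  by_contra hne
  have hne' : i ≠ κ.symm (κ' i) := fun h => hne (by rw [Equiv.eq_symm_apply] at h; exact h.symm)
  refine not_le.2 (hc.lt_dist _ _ hne') ((dist_triangle_max _ _ _).trans (max_le ?_ h2))
  rwa [dist_comm]

/-- Ultrametric balls are nested or disjoint. As they also generate the Borel sets, orthogonality
can be passed from boxes to all measurable sets by a Dynkin argument. -/
theorem isPiSystem_closedBall (Y : Type*) [MetricSpace Y] [IsUltrametricDist Y] :
    IsPiSystem {S : Set Y | ∃ (c : Y) (r : ℝ), 0 < r ∧ S = Metric.closedBall c r} := by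
  rintro _ ⟨c, r, hr, rfl⟩ _ ⟨c', r', hr', rfl⟩ hne
  rcases IsUltrametricDist.closedBall_subset_trichotomy (x := c) (y := c') (r := r) (s := r')
    with h | h | h
  · exact ⟨c, r, hr, Set.inter_eq_left.2 h⟩
  · exact ⟨c', r', hr', Set.inter_eq_right.2 h⟩
  · exact absurd h.inter_eq hne.ne_empty

theorem borel_eq_generateFrom_closedBall (Y : Type*) [MetricSpace Y] [IsUltrametricDist Y]
    [SecondCountableTopology Y] :
    borel Y = MeasurableSpace.generateFrom
      {S : Set Y | ∃ (c : Y) (r : ℝ), 0 < r ∧ S = Metric.closedBall c r} := by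
  refine TopologicalSpace.IsTopologicalBasis.borel_eq_generateFrom ?_
  refine TopologicalSpace.isTopologicalBasis_of_isOpen_of_nhds ?_ ?_
  · rintro _ ⟨c, r, hr, rfl⟩
    exact IsUltrametricDist.isOpen_closedBall c hr.ne'
  · intro a U ha hU
    obtain ⟨ε, hε, hb⟩ := Metric.isOpen_iff.1 hU a ha
    exact ⟨_, ⟨a, ε / 2, half_pos hε, rfl⟩, Metric.mem_closedBall_self (half_pos hε).le,
      (Metric.closedBall_subset_ball (half_lt_self hε)).trans hb⟩

/-! ### Spans of the vectors of boxes of a given radius -/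

variable {W : Type w} [NormedAddCommGroup W] [InnerProductSpace ℂ W]
  (s : MeasurableSection X n) (q : Equiv.Perm (Fin n) →* (W ≃ₗᵢ[ℂ] W))

/-- The span of the vectors attached to boxes of radius `r`. -/
noncomputable def boxSpan (s : MeasurableSection X n) (q : Equiv.Perm (Fin n) →* (W ≃ₗᵢ[ℂ] W))
    (r : ℝ) : Submodule ℂ (Lp W 2 (confMeasure (openHaar X) n)) :=
  Submodule.span ℂ {v | ∃ (c : Fin n → X) (w : W), IsBoxCenter X r c ∧
    v = boxVec (openHaar X) s q (Metric.closedBall c r) w}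

theorem boxVec_mem_boxSpan (hc : IsBoxCenter X r c) (hr' : 0 < r') (h : r' ≤ r) (w : W) :
    boxVec (openHaar X) s q (Metric.closedBall c r) w ∈ boxSpan s q r' := by
  classical
  obtain ⟨T, hTc, hTfin, hT⟩ := hc.isCompact_closedBall.finite_cover_balls hr'
  -- The balls are collected as sets rather than by their centers: equal balls then count once, and
  -- different ones of the same radius are disjoint.
  let B : Finset (Set (Fin n → X)) := hTfin.toFinset.image fun x => Metric.closedBall x r'
  have hB : ∀ S ∈ B, ∃ x, IsBoxCenter X r' x ∧ S = Metric.closedBall x r' ∧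
      Metric.closedBall x r' ⊆ Metric.closedBall c r := by
    intro S hS
    obtain ⟨x, hx, rfl⟩ := Finset.mem_image.1 hS
    have hxc := hTc (hTfin.mem_toFinset.1 hx)
    refine ⟨x, hc.of_mem_closedBall hr' h hxc, rfl, ?_⟩
    rw [IsUltrametricDist.closedBall_eq_of_mem hxc]
    exact Metric.closedBall_subset_closedBall h
  have hU : ⋃ S ∈ B, S = Metric.closedBall c r := by
    refine Set.Subset.antisymm (Set.iUnion₂_subset fun S hS => ?_) fun x hx => ?_
    · obtain ⟨x, -, rfl, hx⟩ := hB S hS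
      exact hx
    · obtain ⟨y, hy, hxy⟩ := Set.mem_iUnion₂.1 (hT hx)
      exact Set.mem_iUnion₂.2 ⟨_, Finset.mem_image_of_mem _ (hTfin.mem_toFinset.2 hy),
        Metric.ball_subset_closedBall hxy⟩
  have key := boxVec_biUnion (m := openHaar X) s q B id
    (fun S hS => by obtain ⟨x, hx, rfl, -⟩ := hB S hS; exact hx.isBoundedMeasurable)
    (by simp only [id]; rw [hU]; exact hc.isBoundedMeasurable)
    (by
      intro S hS S' hS' hne
      obtain ⟨x, -, rfl, -⟩ := hB S hS
      obtain ⟨x', -, rfl, -⟩ := hB S' hS'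
      exact (IsUltrametricDist.closedBall_eq_or_disjoint x x' r').resolve_left hne) w
  simp only [id] at key
  rw [hU] at key
  rw [key]
  refine Submodule.sum_mem _ fun S hS => ?_
  obtain ⟨x, hx, rfl, -⟩ := hB S hS
  exact Submodule.subset_span ⟨x, w, hx, rfl⟩

theorem boxSpan_le (hr' : 0 < r') (h : r' ≤ r) : boxSpan s q r ≤ boxSpan s q r' := by
  refine Submodule.span_le.2 ?_
  rintro _ ⟨c, w, hc, rfl⟩
  exact boxVec_mem_boxSpan s q hc hr' h w

/-- The scalar functions that occur in the inner product of a vector attached to a subset of `S₀`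
with an element of `L²`. -/
noncomputable def boxCoeff (S₀ : Set (Fin n → X)) (w : W) (g : Lp W 2 (confMeasure (openHaar X) n))
    (κ : Equiv.Perm (Fin n)) (γ : Set.powersetCard X n) : ℂ :=
  (s.enum κ ⁻¹' S₀).indicator (fun γ => inner ℂ (q κ w) (g γ)) γ

/-! ### Totality of the vectors attached to boxes -/

variable {s q}

theorem integrable_boxCoeff {S₀ : Set (Fin n → X)} (hS₀ : IsBoundedMeasurable S₀) (w : W)
    (g : Lp W 2 (confMeasure (openHaar X) n)) (κ : Equiv.Perm (Fin n)) :
    Integrable (boxCoeff s q S₀ w g κ) (confMeasure (openHaar X) n) := by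
  have hm := s.measurable_enum κ hS₀.measurableSet
  have hfin := (hS₀.confMeasure_lt_top (m := openHaar X) s κ).ne
  refine (L2.integrable_inner (𝕜 := ℂ) (indicatorConstLp 2 hm hfin (q κ w)) g).congr ?_
  filter_upwards [indicatorConstLp_coeFn (p := 2) (hs := hm) (hμs := hfin) (c := q κ w)] with γ hγ
  rw [hγ, boxCoeff]
  by_cases h : γ ∈ s.enum κ ⁻¹' S₀
  · rw [Set.indicator_of_mem h, Set.indicator_of_mem h]
  · rw [Set.indicator_of_notMem h, Set.indicator_of_notMem h, inner_zero_left]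

/-- Written as a sum of set integrals of fixed integrable functions, the inner product is visibly
countably additive in `S`, as the Dynkin argument requires. -/
theorem inner_boxVec_inter {S S₀ : Set (Fin n → X)} (hS₀ : IsBoundedMeasurable S₀)
    (hS : MeasurableSet S) (w : W) (g : Lp W 2 (confMeasure (openHaar X) n)) :
    inner ℂ (boxVec (openHaar X) s q (S ∩ S₀) w) g =
      ∑ κ, ∫ γ in s.enum κ ⁻¹' S, boxCoeff s q S₀ w g κ γ ∂confMeasure (openHaar X) n := by
  have h1 : ∀ κ, ∫ γ in s.enum κ ⁻¹' S, boxCoeff s q S₀ w g κ γ ∂confMeasure (openHaar X) n =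
      ∫ γ, (s.enum κ ⁻¹' S).indicator (boxCoeff s q S₀ w g κ) γ ∂confMeasure (openHaar X) n :=
    fun κ => (integral_indicator (s.measurable_enum κ hS)).symm
  simp only [h1]
  rw [L2.inner_def, ← integral_finsetSum _ fun κ _ =>
    (integrable_boxCoeff hS₀ w g κ).indicator (s.measurable_enum κ hS)]
  refine integral_congr_ae ?_
  filter_upwards [coeFn_boxVec (m := openHaar X) s q (hS₀.inter_left hS) w] with γ hγ
  rw [hγ, boxFun, sum_inner]
  refine Finset.sum_congr rfl fun κ _ => ?_
  by_cases h : γ ∈ s.enum κ ⁻¹' S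
  · by_cases h' : γ ∈ s.enum κ ⁻¹' S₀
    · rw [Set.indicator_of_mem (show γ ∈ s.enum κ ⁻¹' (S ∩ S₀) from ⟨h, h'⟩),
        Set.indicator_of_mem h, boxCoeff, Set.indicator_of_mem h']
    · rw [Set.indicator_of_notMem (show γ ∉ s.enum κ ⁻¹' (S ∩ S₀) from fun hh => h' hh.2),
        Set.indicator_of_mem h, boxCoeff, Set.indicator_of_notMem h', inner_zero_left]
  · rw [Set.indicator_of_notMem (show γ ∉ s.enum κ ⁻¹' (S ∩ S₀) from fun hh => h hh.1),
      Set.indicator_of_notMem h, inner_zero_left]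

variable {g : Lp W 2 (confMeasure (openHaar X) n)}

theorem inner_boxVec_inter_eq_zero
    (hg : ∀ r c w, IsBoxCenter X r c →
      inner ℂ (boxVec (openHaar X) s q (Metric.closedBall c r) w) g = 0)
    (hc : IsBoxCenter X r c) (w : W) {S : Set (Fin n → X)} (hS : MeasurableSet S) :
    inner ℂ (boxVec (openHaar X) s q (S ∩ Metric.closedBall c r) w) g = 0 := by
  have hb := hc.isBoundedMeasurable
  have hgen : (inferInstance : MeasurableSpace (Fin n → X)) = _ :=
    (BorelSpace.measurable_eq).trans (borel_eq_generateFrom_closedBall (Fin n → X))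
  induction S, hS using MeasurableSpace.induction_on_inter hgen (isPiSystem_closedBall _) with
  | empty => rw [inner_boxVec_inter hb MeasurableSet.empty]; simp
  | basic S hS =>
    obtain ⟨c', r', hr', rfl⟩ := hS
    rcases IsUltrametricDist.closedBall_subset_trichotomy (x := c') (y := c) (r := r') (s := r)
      with h | h | h
    · rw [Set.inter_eq_left.2 h]
      rcases le_total r' r with h' | h'
      · exact hg _ _ _ (hc.of_mem_closedBall hr' h' (h (Metric.mem_closedBall_self hr'.le)))
      -- In an ultrametric space a ball of larger nominal radius can be contained in one of smaller
      -- radius; the two are then the same set.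
      · have : Metric.closedBall c' r' = Metric.closedBall c r := by
          refine h.antisymm ?_
          rw [IsUltrametricDist.closedBall_eq_of_mem (h (Metric.mem_closedBall_self hr'.le))]
          exact Metric.closedBall_subset_closedBall h'
        rw [this]
        exact hg _ _ _ hc
    · rw [Set.inter_eq_right.2 h]
      exact hg _ _ _ hc
    · rw [h.inter_eq]
      have := inner_boxVec_inter (s := s) (q := q) hb MeasurableSet.empty w g
      simpa using this
  | compl S hS ih =>
    rw [inner_boxVec_inter hb hS] at ih
    rw [inner_boxVec_inter hb hS.compl]
    have huniv := inner_boxVec_inter (s := s) (q := q) hb MeasurableSet.univ w g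
    rw [Set.univ_inter, hg _ _ _ hc] at huniv
    have : ∀ κ, ∫ γ in s.enum κ ⁻¹' Sᶜ, boxCoeff s q (Metric.closedBall c r) w g κ γ
          ∂confMeasure (openHaar X) n =
        ∫ γ, boxCoeff s q (Metric.closedBall c r) w g κ γ ∂confMeasure (openHaar X) n -
        ∫ γ in s.enum κ ⁻¹' S, boxCoeff s q (Metric.closedBall c r) w g κ γ
          ∂confMeasure (openHaar X) n := fun κ => by
      rw [eq_sub_iff_add_eq', Set.preimage_compl]
      exact integral_add_compl (s.measurable_enum κ hS) (integrable_boxCoeff hb w g κ)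
    simp only [this, Finset.sum_sub_distrib, ih, sub_zero]
    simpa using huniv.symm
  | iUnion S hd hS ih =>
    rw [inner_boxVec_inter hb (MeasurableSet.iUnion hS)]
    have h1 : HasSum (fun i => ∑ κ, ∫ γ in s.enum κ ⁻¹' S i,
          boxCoeff s q (Metric.closedBall c r) w g κ γ ∂confMeasure (openHaar X) n)
        (∑ κ, ∫ γ in s.enum κ ⁻¹' (⋃ i, S i),
          boxCoeff s q (Metric.closedBall c r) w g κ γ ∂confMeasure (openHaar X) n) := by
      refine hasSum_sum fun κ _ => ?_
      rw [Set.preimage_iUnion]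
      exact hasSum_integral_iUnion (fun i => s.measurable_enum κ (hS i))
        (fun i j hij => (hd hij).preimage _) (integrable_boxCoeff hb w g κ).integrableOn
    have h2 : (fun i => ∑ κ, ∫ γ in s.enum κ ⁻¹' S i,
          boxCoeff s q (Metric.closedBall c r) w g κ γ ∂confMeasure (openHaar X) n) = 0 := by
      ext1 i
      rw [← inner_boxVec_inter hb (hS i)]
      exact ih i
    rw [h2] at h1
    exact h1.unique hasSum_zero

theorem MeasurableSection.enum_mem_image_iff (κ : Equiv.Perm (Fin n)) (γ : Set.powersetCard X n)
    (E : Set (Set.powersetCard X n)) :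
    s.enum κ γ ∈ (Subtype.val : DistinctTuple X n → Fin n → X) '' (toSubset ⁻¹' E) ↔ γ ∈ E := by
  have h : ∀ x : DistinctTuple X n, x.1 = s.enum κ γ → toSubset x = γ := by
    intro x hx
    rw [← s.toSubset_toFun γ]
    ext a
    rw [mem_toSubset, mem_toSubset, hx]
    exact ⟨fun ⟨i, hi⟩ => ⟨κ i, hi⟩, fun ⟨i, hi⟩ => ⟨κ.symm i, by simpa [enum] using hi⟩⟩
  constructor
  · rintro ⟨x, hx, hxγ⟩
    rwa [← h x hxγ]
  · exact fun hγ => ⟨⟨s.enum κ γ, (s.toFun γ).2.comp κ.injective⟩, by rwa [Set.mem_preimage, h _ rfl],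
      rfl⟩

/-- For measurable `E`, let `S` consist of all enumerations of members of `E`. This set is
symmetric, so its preimage under every `s.enum κ` is `E`, and the vanishing inner product becomes
the integral over `E`. -/
theorem sum_boxCoeff_ae_eq_zero
    (hg : ∀ r c w, IsBoxCenter X r c →
      inner ℂ (boxVec (openHaar X) s q (Metric.closedBall c r) w) g = 0)
    (hc : IsBoxCenter X r c) (w : W) :
    (fun γ => ∑ κ, boxCoeff s q (Metric.closedBall c r) w g κ γ)
      =ᵐ[confMeasure (openHaar X) n] 0 := by
  have hb := hc.isBoundedMeasurable
  refine (integrable_finsetSum _ fun κ _ =>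
    integrable_boxCoeff hb w g κ).ae_eq_zero_of_forall_setIntegral_eq_zero fun E hE _ => ?_
  rw [integral_finsetSum _ fun κ _ => (integrable_boxCoeff hb w g κ).integrableOn]
  have hS : MeasurableSet ((Subtype.val : DistinctTuple X n → Fin n → X) '' (toSubset ⁻¹' E)) :=
    measurableEmbedding_distinctTuple.measurableSet_image.2 (measurable_toSubset hE)
  have h1 := inner_boxVec_inter_eq_zero hg hc w hS
  rw [inner_boxVec_inter hb hS] at h1
  rw [← h1]
  refine Finset.sum_congr rfl fun κ _ => ?_
  congr 2
  ext γ
  exact (MeasurableSection.enum_mem_image_iff κ γ E).symm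

/-- Only one enumeration lies in the box, so the sum in `sum_boxCoeff_ae_eq_zero` has a single term,
and `g γ` is orthogonal to `q(κ) w`. Letting `w` run through a finite basis costs only finitely many
null sets. -/
theorem ae_eq_zero_of_enum_mem [FiniteDimensional ℂ W]
    (hg : ∀ r c w, IsBoxCenter X r c →
      inner ℂ (boxVec (openHaar X) s q (Metric.closedBall c r) w) g = 0)
    (hc : IsBoxCenter X r c) :
    ∀ᵐ γ ∂confMeasure (openHaar X) n, ∀ κ, s.enum κ γ ∈ Metric.closedBall c r → g γ = 0 := by
  have h := ae_all_iff.2 fun i => sum_boxCoeff_ae_eq_zero hg hc (Module.finBasis ℂ W i)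
  filter_upwards [h] with γ hγ κ hκ
  have key : ∀ i, inner ℂ (g γ) (q κ (Module.finBasis ℂ W i)) = 0 := by
    intro i
    have := hγ i
    rw [Finset.sum_eq_single κ, boxCoeff, Set.indicator_of_mem (s := s.enum κ ⁻¹' _) hκ] at this
    · rw [← inner_conj_symm, this]; simp
    · intro κ' _ hne
      exact Set.indicator_of_notMem (s := s.enum κ' ⁻¹' _)
        (fun h' => hne (hc.enum_unique s hκ h')) _
    · simp
  have hlin : (innerSL ℂ (g γ) : W →L[ℂ] ℂ).toLinearMap ∘ₗ (q κ).toLinearEquiv.toLinearMap = 0 :=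
    (Module.finBasis ℂ W).ext fun i => by simpa using key i
  have h2 := LinearMap.congr_fun hlin ((q κ).symm (g γ))
  simpa using h2

/-- The vectors attached to boxes span a dense subspace. -/
theorem eq_zero_of_forall_inner_boxVec_eq_zero [FiniteDimensional ℂ W]
    (hg : ∀ r c w, IsBoxCenter X r c →
      inner ℂ (boxVec (openHaar X) s q (Metric.closedBall c r) w) g = 0) : g = 0 := by
  -- Countably many boxes, with centers in `D` and radii `1 / (k + 1)`, contain all tuples of
  -- distinct points, so the exceptional null sets can be united.
  obtain ⟨D, hD, hDd⟩ := TopologicalSpace.exists_countable_dense (Fin n → X)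
  have h : ∀ᵐ γ ∂confMeasure (openHaar X) n, ∀ k : ℕ, ∀ c ∈ D,
      IsBoxCenter X (1 / ((k : ℝ) + 1)) c → ∀ κ, s.enum κ γ ∈ Metric.closedBall c (1 / ((k : ℝ) + 1)) →
      g γ = 0 := by
    refine ae_all_iff.2 fun k => (ae_ball_iff hD).2 fun c _ => ?_
    by_cases hc : IsBoxCenter X (1 / ((k : ℝ) + 1)) c
    · exact (ae_eq_zero_of_enum_mem hg hc).mono fun γ hγ _ => hγ
    · exact ae_of_all _ fun γ h => absurd h hc
  rw [Lp.eq_zero_iff_ae_eq_zero]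
  filter_upwards [h] with γ hγ
  have hinj : Function.Injective (s.enum 1 γ) := (s.toFun γ).2
  have hlim : Tendsto (fun k : ℕ => 1 / ((k : ℝ) + 1)) atTop (𝓝[>] 0) :=
    tendsto_nhdsWithin_iff.2 ⟨tendsto_one_div_add_atTop_nhds_zero_nat,
      Eventually.of_forall fun k => by simp only [Set.mem_Ioi]; positivity⟩
  obtain ⟨k, hk⟩ := (hlim.eventually (IsBoxCenter.eventually hinj)).exists
  obtain ⟨c, hcD, hc⟩ := Metric.dense_iff.1 hDd (s.enum 1 γ) _ hk.pos
  have hc' := (Metric.ball_subset_closedBall hcD)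
  refine hγ k c hc (hk.of_mem_closedBall hk.pos le_rfl hc') 1 ?_
  rwa [Metric.mem_closedBall, dist_comm]

theorem iSup_boxSpan_dense [FiniteDimensional ℂ W] (s : MeasurableSection X n)
    (q : Equiv.Perm (Fin n) →* (W ≃ₗᵢ[ℂ] W)) :
    (⨆ r, boxSpan s q r).topologicalClosure = ⊤ := by
  rw [Submodule.topologicalClosure_eq_top_iff, Submodule.eq_bot_iff]
  intro g hg
  refine eq_zero_of_forall_inner_boxVec_eq_zero (s := s) (q := q) fun r c w hc => ?_
  exact (Submodule.mem_orthogonal _ _).1 hg _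
    (Submodule.mem_iSup_of_mem r (Submodule.subset_span ⟨c, w, hc, rfl⟩))

/-- A finite combination of box vectors is supported on the `n`-point subsets of one compact set. -/
theorem exists_isCompact_inner_eq_zero {u : Lp W 2 (confMeasure (openHaar X) n)}
    (hu : u ∈ ⨆ r, boxSpan s q r) :
    ∃ Y : Set X, IsCompact Y ∧ ∀ S : Set (Fin n → X), IsBoundedMeasurable S → ∀ j : Fin n,
      (∀ x ∈ S, x j ∉ Y) → ∀ w, inner ℂ u (boxVec (openHaar X) s q S w) = 0 := by
  induction hu using Submodule.iSup_induction' with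
  | mem r u hu =>
    induction hu using Submodule.span_induction with
    | mem u hu =>
      obtain ⟨c, w, hc, rfl⟩ := hu
      exact ⟨_, hc.isCompact_iUnion, fun S hS j hj w' =>
        inner_boxVec_eq_zero s q hc.isBoundedMeasurable hS (fun x hx => hc.mem_iUnion hx) hj w w'⟩
    | zero => exact ⟨∅, isCompact_empty, fun _ _ _ _ _ => inner_zero_left _⟩
    | add u v _ _ hu hv =>
      obtain ⟨Y, hY, h⟩ := hu
      obtain ⟨Z, hZ, h'⟩ := hv
      refine ⟨Y ∪ Z, hY.union hZ, fun S hS j hj w => ?_⟩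
      rw [inner_add_left, h S hS j fun x hx hxY => hj x hx (Or.inl hxY),
        h' S hS j fun x hx hxZ => hj x hx (Or.inr hxZ), add_zero]
    | smul a u _ hu =>
      obtain ⟨Y, hY, h⟩ := hu
      exact ⟨Y, hY, fun S hS j hj w => by rw [inner_smul_left, h S hS j hj w, mul_zero]⟩
  | zero => exact ⟨∅, isCompact_empty, fun _ _ _ _ _ => inner_zero_left _⟩
  | add u v _ _ hu hv =>
    obtain ⟨Y, hY, h⟩ := hu
    obtain ⟨Z, hZ, h'⟩ := hv
    refine ⟨Y ∪ Z, hY.union hZ, fun S hS j hj w => ?_⟩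
    rw [inner_add_left, h S hS j fun x hx hxY => hj x hx (Or.inl hxY),
      h' S hS j fun x hx hxZ => hj x hx (Or.inr hxZ), add_zero]

/-- Every element of `L²` is almost orthogonal to the vectors attached to sets of tuples with a
component far out. -/
theorem exists_isCompact_norm_inner_le [FiniteDimensional ℂ W] (s : MeasurableSection X n)
    (q : Equiv.Perm (Fin n) →* (W ≃ₗᵢ[ℂ] W)) (u : Lp W 2 (confMeasure (openHaar X) n)) {ε : ℝ}
    (hε : 0 < ε) :
    ∃ Y : Set X, IsCompact Y ∧ ∀ S : Set (Fin n → X), IsBoundedMeasurable S → ∀ j : Fin n,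
      (∀ x ∈ S, x j ∉ Y) → ∀ w, ‖inner ℂ u (boxVec (openHaar X) s q S w)‖ ≤
        ε * ‖boxVec (openHaar X) s q S w‖ := by
  have hu : u ∈ (⨆ r, boxSpan s q r).topologicalClosure := by
    rw [iSup_boxSpan_dense]; trivial
  obtain ⟨u', hu', hdist⟩ := Metric.mem_closure_iff.1 hu ε hε
  obtain ⟨Y, hY, h⟩ := exists_isCompact_inner_eq_zero hu'
  refine ⟨Y, hY, fun S hS j hj w => ?_⟩
  have : inner ℂ u (boxVec (openHaar X) s q S w) = inner ℂ (u - u') (boxVec (openHaar X) s q S w) := by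
    rw [inner_sub_left, h S hS j hj w, sub_zero]
  rw [this]
  refine (norm_inner_le_norm _ _).trans (mul_le_mul_of_nonneg_right ?_ (norm_nonneg _))
  rw [← dist_eq_norm]; exact hdist.le

end Boxes

/-! ### Irreducible unitary representations of a finite group -/

section Schur

variable {W : Type w} [NormedAddCommGroup W] [InnerProductSpace ℂ W] {G : Type*} [Group G]
  {q : G →* (W ≃ₗᵢ[ℂ] W)}

/-- The span of the finite orbit of a nonzero vector is invariant, and closed because it is
finite-dimensional. -/
theorem finiteDimensional_of_isIrreducibleFamily [Finite G]
    (hq : IsIrreducibleFamily (Set.range q)) : FiniteDimensional ℂ W := by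
  obtain ⟨⟨x, y, hxy⟩, hirr⟩ := hq
  let w := x - y
  have hw : w ≠ 0 := sub_ne_zero.2 hxy
  let M : Submodule ℂ W := Submodule.span ℂ (Set.range fun κ => q κ w)
  have hfg : M.FG := Submodule.fg_span (Set.finite_range _)
  have : FiniteDimensional ℂ M := Module.Finite.of_fg hfg
  have hwM : w ∈ M := Submodule.subset_span ⟨1, by simp⟩
  have htop : M = ⊤ := by
    refine (hirr M M.closed_of_finiteDimensional ?_).resolve_left fun h => hw ?_
    · rintro _ ⟨κ, rfl⟩ v hv
      have : M ≤ M.comap (q κ).toLinearEquiv.toLinearMap := by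
        refine Submodule.span_le.2 ?_
        rintro _ ⟨κ', rfl⟩
        exact Submodule.subset_span ⟨κ * κ', by simp [map_mul]⟩
      exact this hv
    · rwa [h, Submodule.mem_bot] at hwM
  exact ⟨htop ▸ hfg⟩

/-- Schur's lemma. -/
theorem exists_eq_smul_of_commute [FiniteDimensional ℂ W] (hq : IsIrreducibleFamily (Set.range q))
    (L : W →ₗ[ℂ] W) (hL : ∀ κ w, L (q κ w) = q κ (L w)) : ∃ a : ℂ, ∀ w, L w = a • w := by
  have := hq.1
  obtain ⟨a, ha⟩ := Module.End.exists_eigenvalue L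
  refine ⟨a, fun w => ?_⟩
  rw [← Module.End.mem_eigenspace_iff]
  have htop : Module.End.eigenspace L a = ⊤ := by
    refine (hq.2 _ (Submodule.closed_of_finiteDimensional _) ?_).resolve_left ha
    rintro _ ⟨κ, rfl⟩ v hv
    rw [Module.End.mem_eigenspace_iff] at hv ⊢
    rw [hL, hv, map_smul]
  rw [htop]; trivial

/-- The compression `E* A E` of `A` to `W` commutes with `q`, so Schur's lemma makes it a scalar;
the conjugate of that scalar is the constant, the inner product being conjugate-linear in the first
variable. -/
theorem exists_inner_eq_mul_inner [FiniteDimensional ℂ W]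
    (hq : IsIrreducibleFamily (Set.range q)) {H : Type*} [NormedAddCommGroup H]
    [InnerProductSpace ℂ H] [CompleteSpace H] (A : H →L[ℂ] H) (E : W →ₗ[ℂ] H)
    (h : ∀ κ w w', inner ℂ (A (E (q κ w))) (E (q κ w')) = inner ℂ (A (E w)) (E w')) :
    ∃ a : ℂ, ∀ w w', inner ℂ (A (E w)) (E w') = a * inner ℂ w w' := by
  have : CompleteSpace W := FiniteDimensional.complete ℂ W
  let E' : W →L[ℂ] H := E.toContinuousLinearMap
  let L : W →L[ℂ] W := (ContinuousLinearMap.adjoint E').comp (A.comp E')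
  have hL : ∀ w w', inner ℂ (L w) w' = inner ℂ (A (E w)) (E w') := fun w w' =>
    ContinuousLinearMap.adjoint_inner_left E' w' (A (E' w))
  obtain ⟨a, ha⟩ := exists_eq_smul_of_commute hq L.toLinearMap (by
    intro κ w
    refine ext_inner_right ℂ fun w' => ?_
    obtain ⟨w', rfl⟩ := (q κ).surjective w'
    change inner ℂ (L (q κ w)) _ = inner ℂ (q κ (L w)) _
    rw [LinearIsometryEquiv.inner_map_map, hL, hL, h])
  refine ⟨starRingEnd ℂ a, fun w w' => ?_⟩
  rw [← hL, ← inner_smul_left]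
  exact congrArg (fun v => inner ℂ v w') (ha w)

end Schur

/-! ### Operators commuting with the swaps -/

section Commutant

variable {K : Type u} [NontriviallyNormedField K] [IsUltrametricDist K] [ProperSpace K]
  [MeasurableSpace K] [BorelSpace K] {d : ℕ}
  {X : TopologicalSpace.Opens (Fin d → K)} {r r' : ℝ} {n : ℕ} {c c' : Fin n → X}
  {W : Type w} [NormedAddCommGroup W] [InnerProductSpace ℂ W]
  {s : MeasurableSection X n} {q : Equiv.Perm (Fin n) →* (W ≃ₗᵢ[ℂ] W)}

theorem mem_quasiInvGroup_of_mem_swapGroup {g : X ≃ₜ X} (hg : g ∈ swapGroup X r) :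
    g ∈ quasiInvGroup (openHaar X) n :=
  mem_quasiInvGroup_of_map_eq (map_openHaar_of_mem_swapGroup hg)

/-- The sesquilinear form of `A` is invariant under all swaps of balls. -/
def IsSwapInvariant (s : MeasurableSection X n) (q : Equiv.Perm (Fin n) →* (W ≃ₗᵢ[ℂ] W))
    (A : Lp W 2 (confMeasure (openHaar X) n) →L[ℂ] Lp W 2 (confMeasure (openHaar X) n)) : Prop :=
  ∀ (r : ℝ) (g : X ≃ₜ X) (hg : g ∈ swapGroup X r) (u v : Lp W 2 (confMeasure (openHaar X) n)),
    inner ℂ (A (repV (openHaar X) s q ⟨g, mem_quasiInvGroup_of_mem_swapGroup hg⟩ u))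
      (repV (openHaar X) s q ⟨g, mem_quasiInvGroup_of_mem_swapGroup hg⟩ v) = inner ℂ (A u) v

/-- Through this the results on matrix coefficients of `A` also compute the inner products of box
vectors. -/
theorem isSwapInvariant_id :
    IsSwapInvariant s q (ContinuousLinearMap.id ℂ (Lp W 2 (confMeasure (openHaar X) n))) :=
  fun _ g hg u v => LinearIsometryEquiv.inner_map_map
    (repV (openHaar X) s q ⟨g, mem_quasiInvGroup_of_mem_swapGroup hg⟩) u v

variable {A : Lp W 2 (confMeasure (openHaar X) n) →L[ℂ] Lp W 2 (confMeasure (openHaar X) n)}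

theorem IsSwapInvariant.inner_preimage (hA : IsSwapInvariant s q A) {g : X ≃ₜ X}
    (hg : g ∈ swapGroup X r) {S S' : Set (Fin n → X)} (hS : IsBoundedMeasurable S)
    (hS' : IsBoundedMeasurable S') (w w' : W) :
    inner ℂ (A (boxVec (openHaar X) s q {x | (fun i => g⁻¹ (x i)) ∈ S} w))
      (boxVec (openHaar X) s q {x | (fun i => g⁻¹ (x i)) ∈ S'} w') =
    inner ℂ (A (boxVec (openHaar X) s q S w)) (boxVec (openHaar X) s q S' w') := by
  rw [← hA r g hg (boxVec _ s q S w), repV_boxVec s q (map_openHaar_of_mem_swapGroup hg) hS,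
    repV_boxVec s q (map_openHaar_of_mem_swapGroup hg) hS']

theorem IsBoxCenter.preimage_closedBall (hc : IsBoxCenter X r c) {g : X ≃ₜ X}
    (hg : g ∈ swapGroup X r) (h : ∀ i, dist (g (c i)) (c' i) ≤ r) :
    {x : Fin n → X | (fun i => g⁻¹ (x i)) ∈ Metric.closedBall c r} = Metric.closedBall c' r := by
  ext x
  simp only [Set.mem_ofPred_eq, Metric.mem_closedBall, dist_pi_le_iff hc.pos.le]
  refine forall_congr' fun i => ?_
  rw [← dist_apply_le_iff hg, show g (g⁻¹ (x i)) = x i from g.right_inv _]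
  have h' := h i
  constructor
  · exact fun hx => (dist_triangle_max _ _ _).trans (max_le hx h')
  · exact fun hx => (dist_triangle_max _ _ _).trans (max_le hx (by rwa [dist_comm]))

theorem IsSwapInvariant.inner_box_eq (hA : IsSwapInvariant s q A) (hc : IsBoxCenter X r c)
    (hc' : IsBoxCenter X r c') (w w' : W) :
    inner ℂ (A (boxVec (openHaar X) s q (Metric.closedBall c r) w))
      (boxVec (openHaar X) s q (Metric.closedBall c r) w') =
    inner ℂ (A (boxVec (openHaar X) s q (Metric.closedBall c' r) w))
      (boxVec (openHaar X) s q (Metric.closedBall c' r) w') := by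
  obtain ⟨g, hg, h⟩ := exists_swapGroup_forall_dist_le hc hc'
  rw [← hc.preimage_closedBall hg h]
  exact (hA.inner_preimage hg hc.isBoundedMeasurable hc.isBoundedMeasurable w w').symm

theorem IsBoxCenter.perm (hc : IsBoxCenter X r c) (κ : Equiv.Perm (Fin n)) :
    IsBoxCenter X r fun i => c (κ i) :=
  ⟨hc.pos, fun _ _ hij => hc.lt_dist _ _ (κ.injective.ne hij), fun i => hc.subset (κ i)⟩

/-- Swaps can permute the balls of a box, and by this identity such swaps realize the representation
`q` on its vectors. -/
theorem IsBoxCenter.boxVec_perm (hc : IsBoxCenter X r c) (κ : Equiv.Perm (Fin n)) (w : W) :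
    boxVec (openHaar X) s q (Metric.closedBall (fun i => c (κ i)) r) w =
      boxVec (openHaar X) s q (Metric.closedBall c r) (q κ w) := by
  have h := _root_.boxVec_perm (m := openHaar X) s q (Metric.closedBall c r) κ⁻¹ w
  rw [inv_inv] at h
  rw [← h]
  congr 1
  ext x
  simp only [Set.mem_ofPred_eq, Metric.mem_closedBall, dist_pi_le_iff hc.pos.le]
  exact ⟨fun hx i => by simpa using hx (κ⁻¹ i), fun hx i => by simpa using hx (κ i)⟩

/-! ### Matrix coefficients between boxes, and scalarity -/

variable [FiniteDimensional ℂ W]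

/-- A box with permuted centers can be reached by swaps, so the form of `A` on the vectors of one
box is `q`-invariant and Schur's lemma applies. Transitivity on boxes makes the constant independent
of `c`. -/
theorem IsSwapInvariant.exists_inner_box_self (hA : IsSwapInvariant s q A)
    (hq : IsIrreducibleFamily (Set.range q)) (r : ℝ) :
    ∃ a : ℂ, ∀ c : Fin n → X, IsBoxCenter X r c → ∀ w w',
      inner ℂ (A (boxVec (openHaar X) s q (Metric.closedBall c r) w))
        (boxVec (openHaar X) s q (Metric.closedBall c r) w') = a * inner ℂ w w' := by
  by_cases h : ∃ c : Fin n → X, IsBoxCenter X r c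
  · obtain ⟨c, hc⟩ := h
    obtain ⟨a, ha⟩ := exists_inner_eq_mul_inner hq A
      (boxLin (openHaar X) s q hc.isBoundedMeasurable) fun κ w w' => by
        simp only [boxLin_apply]
        rw [← hc.boxVec_perm, ← hc.boxVec_perm]
        exact hA.inner_box_eq (hc.perm κ) hc w w'
    refine ⟨a, fun c' hc' w w' => ?_⟩
    rw [← hA.inner_box_eq hc hc']
    exact ha w w'
  · exact ⟨0, fun c hc => absurd ⟨c, hc⟩ h⟩

/-- The `j`-th ball of the second box can be moved arbitrarily far without changing the matrix
coefficient, and coefficients with vectors far out are arbitrarily small. -/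
theorem IsSwapInvariant.inner_box_eq_zero (hX : openHaar X Set.univ = ∞)
    (hA : IsSwapInvariant s q A) (hc : IsBoxCenter X r c) (hc' : IsBoxCenter X r c') {j : Fin n}
    (hj : ∀ i, ¬ dist (c' j) (c i) ≤ r) (w w' : W) :
    inner ℂ (A (boxVec (openHaar X) s q (Metric.closedBall c r) w))
      (boxVec (openHaar X) s q (Metric.closedBall c' r) w') = 0 := by
  set z := inner ℂ (A (boxVec (openHaar X) s q (Metric.closedBall c r) w))
    (boxVec (openHaar X) s q (Metric.closedBall c' r) w') with hz
  set C := ‖boxVec (openHaar X) s q (Metric.closedBall c' r) w'‖ with hC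
  have key : ∀ ε > 0, ‖z‖ ≤ ε * C := by
    intro ε hε
    obtain ⟨Y, hY, hdecay⟩ := exists_isCompact_norm_inner_le s q
      (A (boxVec (openHaar X) s q (Metric.closedBall c r) w)) hε
    -- The compact set includes the balls of the first box, which `g` therefore fixes pointwise,
    -- being disjoint from the ball that is moved.
    obtain ⟨ρ, g, hg, hfix, hoff⟩ := exists_swapGroup_move_off hX hc.pos (hc'.subset j)
      (hY.union (hc.isCompact_iUnion.union (isCompact_closedBall_of_subset (hc'.subset j))))
      fun x hx => Or.inr (Or.inr hx)
    have hginv : ∀ y, g (g⁻¹ y) = y := g.right_inv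
    have hgc : ∀ (y : X) i, dist y (c i) ≤ r → g y = y := by
      intro y i hy
      refine hfix y (Or.inr (Or.inl (Set.mem_iUnion.2 ⟨i, hy⟩))) fun hyj => hj i ?_
      exact (dist_triangle_max _ y _).trans (max_le (by rwa [dist_comm]) hy)
    have hpre : {x : Fin n → X | (fun i => g⁻¹ (x i)) ∈ Metric.closedBall c r} =
        Metric.closedBall c r := by
      ext x
      simp only [Set.mem_ofPred_eq, Metric.mem_closedBall, dist_pi_le_iff hc.pos.le]
      refine forall_congr' fun i => ⟨fun h => ?_, fun h => ?_⟩
      · have := hgc _ i h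
        rw [hginv] at this
        rwa [← this] at h
      · have : g⁻¹ (x i) = x i := by
          conv_lhs => rw [← hgc _ i h]
          simp
        rwa [this]
    have h1 := hA.inner_preimage hg hc.isBoundedMeasurable hc'.isBoundedMeasurable w w'
    rw [hpre] at h1
    have h2 := hdecay _ (hc'.isBoundedMeasurable.preimage g) j (by
      intro x hx hxY
      have hxj : dist (g⁻¹ (x j)) (c' j) ≤ r := (dist_pi_le_iff hc.pos.le).1 hx j
      refine hoff _ hxj ?_
      rw [hginv]
      exact Or.inl hxY) w'
    rw [h1, ← repV_boxVec s q (map_openHaar_of_mem_swapGroup hg) hc'.isBoundedMeasurable,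
      LinearIsometryEquiv.norm_map] at h2
    exact h2
  by_contra hne
  have hpos : 0 < ‖z‖ := norm_pos_iff.2 hne
  have hC0 : 0 ≤ C := norm_nonneg _
  -- The denominator is `C + 1` because `C` may be `0`.
  have := key (‖z‖ / (C + 1)) (by positivity)
  rw [div_mul_eq_mul_div, le_div_iff₀ (by positivity)] at this
  nlinarith

/-- The function has the nonzero value `q(κ) w` at every subset with an enumeration in the box, and
the box is open and nonempty, hence of positive measure. -/
theorem boxVec_ne_zero (hc : IsBoxCenter X r c) {w : W} (hw : w ≠ 0) :
    boxVec (openHaar X) s q (Metric.closedBall c r) w ≠ 0 := by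
  intro h0
  have hb := hc.isBoundedMeasurable
  let E : Set (Set.powersetCard X n) := ⋃ κ, s.enum κ ⁻¹' Metric.closedBall c r
  have hE : MeasurableSet E := MeasurableSet.iUnion fun κ => s.measurable_enum κ hb.measurableSet
  have h1 : confMeasure (openHaar X) n E = 0 := by
    have h2 : boxFun s q (Metric.closedBall c r) w =ᵐ[confMeasure (openHaar X) n] 0 :=
      (coeFn_boxVec s q hb w).symm.trans (by rw [h0]; exact Lp.coeFn_zero _ _ _)
    refine measure_mono_null (fun γ hγ => ?_) h2
    obtain ⟨κ, hκ⟩ := Set.mem_iUnion.1 hγ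
    change ¬ boxFun s q (Metric.closedBall c r) w γ = 0
    rw [boxFun_eq_of_mem s q (S := Metric.closedBall c r) hκ fun κ' hκ' => hc.enum_unique s hκ hκ']
    simpa using hw
  rw [confMeasure_apply hE] at h1
  have h3 : Metric.closedBall c r ⊆
      (Subtype.val : DistinctTuple X n → Fin n → X) '' (toSubset ⁻¹' E) := by
    intro x hx
    have hx' := hc.of_mem_closedBall hc.pos le_rfl hx
    have hinj : Function.Injective x := fun i j hij => by
      by_contra hne
      have := hx'.lt_dist i j hne
      rw [hij, dist_self] at this
      exact lt_asymm this hc.pos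
    obtain ⟨κ, hκ⟩ := s.exists_enum_toSubset ⟨x, hinj⟩ 1
    refine ⟨⟨x, hinj⟩, Set.mem_iUnion.2 ⟨κ, ?_⟩, rfl⟩
    rw [Set.mem_preimage, hκ]
    exact hx
  exact (IsUltrametricDist.isOpen_closedBall c hc.pos.ne').measure_ne_zero
    (Measure.pi fun _ => openHaar X) ⟨c, Metric.mem_closedBall_self hc.pos.le⟩
    (measure_mono_null h3 h1)

/-- Two boxes of equal radius either agree up to a permutation, where Schur's lemma applies, or give
coefficient `0` both for `A` and for the identity. -/
theorem IsSwapInvariant.exists_inner_boxSpan (hX : openHaar X Set.univ = ∞)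
    (hA : IsSwapInvariant s q A) (hq : IsIrreducibleFamily (Set.range q)) (r : ℝ) :
    ∃ a : ℂ, ∀ u ∈ boxSpan s q r, ∀ v ∈ boxSpan s q r, inner ℂ (A u) v = a * inner ℂ u v := by
  obtain ⟨a, ha⟩ := hA.exists_inner_box_self hq r
  obtain ⟨b, hb⟩ := (isSwapInvariant_id (X := X) (s := s) (q := q)).exists_inner_box_self hq r
  -- The constants `a` for `A` and `b` for the identity are relative to the inner product of `W`. If
  -- `b = 0` there are no boxes of radius `r`, and the span is zero.
  refine ⟨a / b, fun u hu v hv => ?_⟩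
  induction hu, hv using Submodule.span_induction₂ with
  | mem_mem u v hu hv =>
    obtain ⟨c, w, hc, rfl⟩ := hu
    obtain ⟨c', w', hc', rfl⟩ := hv
    by_cases h : ∃ j, ∀ i, ¬ dist (c' j) (c i) ≤ r
    · obtain ⟨j, hj⟩ := h
      have h0 := (isSwapInvariant_id (X := X) (s := s) (q := q)).inner_box_eq_zero hX hc hc' hj w w'
      rw [ContinuousLinearMap.id_apply] at h0
      rw [hA.inner_box_eq_zero hX hc hc' hj, h0, mul_zero]
    · push Not at h
      -- Every ball of the second box is now a ball of the first, and different ones are different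
      -- balls, so the boxes agree up to the permutation `f`.
      choose f hf using h
      have hinj : Function.Injective f := by
        intro i j hij
        by_contra hne
        refine not_le.2 (hc'.lt_dist i j hne) ((dist_triangle_max _ (c (f i)) _).trans
          (max_le (hf i) ?_))
        rw [hij, dist_comm]; exact hf j
      let κ : Equiv.Perm (Fin n) := Equiv.ofBijective f (Finite.injective_iff_bijective.1 hinj)
      have hball : Metric.closedBall c' r = Metric.closedBall (fun i => c (κ i)) r :=
        (IsUltrametricDist.closedBall_eq_of_mem ((dist_pi_le_iff hc.pos.le).2 hf)).symm
      rw [hball, hc.boxVec_perm, ha c hc]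
      have h1 := hb c hc w (q κ w')
      have h2 := hb c hc w w
      rw [ContinuousLinearMap.id_apply] at h1 h2
      rw [h1]
      rcases eq_or_ne w 0 with rfl | hw
      · simp
      · have hb0 : b ≠ 0 := by
          rintro rfl
          rw [zero_mul, inner_self_eq_zero] at h2
          exact boxVec_ne_zero hc hw h2
        field_simp
  | zero_left v _ => simp
  | zero_right u _ => simp
  | add_left u u' v _ _ _ h h' => rw [map_add, inner_add_left, inner_add_left, h, h', mul_add]
  | add_right u v v' _ _ _ h h' => rw [inner_add_right, inner_add_right, h, h', mul_add]
  | smul_left z u v _ _ h => rw [map_smul, inner_smul_left, inner_smul_left, h, mul_left_comm]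
  | smul_right z u v _ _ h => rw [inner_smul_right, inner_smul_right, h, mul_left_comm]

theorem exists_isBoxCenter (hX : openHaar X Set.univ = ∞) (n : ℕ) :
    ∃ (r : ℝ) (c : Fin n → X), IsBoxCenter X r c := by
  have : Infinite X := by
    by_contra h
    have : Finite X := not_infinite_iff_finite.1 h
    exact (isCompact_univ (X := X)).measure_lt_top.ne hX
  obtain ⟨r, hr⟩ := (IsBoxCenter.eventually (X := X)
    (x := fun i : Fin n => Infinite.natEmbedding X i)
    ((Infinite.natEmbedding X).injective.comp Fin.val_injective)).exists
  exact ⟨r, _, hr⟩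

/-- The spans increase as `r > 0` decreases and vanish for `r ≤ 0`, so their supremum is a directed
union over small positive radii. -/
theorem exists_mem_boxSpan {r₀ : ℝ} (hr₀ : 0 < r₀) {u : Lp W 2 (confMeasure (openHaar X) n)}
    (hu : u ∈ ⨆ r, boxSpan s q r) : ∃ r, 0 < r ∧ r ≤ r₀ ∧ u ∈ boxSpan s q r := by
  induction hu using Submodule.iSup_induction' with
  | mem r u hu =>
    rcases lt_or_ge 0 r with hr | hr
    · exact ⟨min r r₀, lt_min hr hr₀, min_le_right _ _,
        boxSpan_le s q (lt_min hr hr₀) (min_le_left _ _) hu⟩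
    · refine ⟨r₀, hr₀, le_rfl, ?_⟩
      have : boxSpan s q r ≤ boxSpan s q r₀ := by
        refine Submodule.span_le.2 ?_
        rintro _ ⟨c, w, hc, rfl⟩
        exact absurd hc.pos (not_lt.2 hr)
      exact this hu
  | zero => exact ⟨r₀, hr₀, le_rfl, zero_mem _⟩
  | add u v _ _ hu hv =>
    obtain ⟨r, hr, hr', hu⟩ := hu
    obtain ⟨t, ht, ht', hv⟩ := hv
    have h0 := lt_min hr ht
    exact ⟨min r t, h0, (min_le_left _ _).trans hr', add_mem
      (boxSpan_le s q h0 (min_le_left _ _) hu) (boxSpan_le s q h0 (min_le_right _ _) hv)⟩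

/-- A bounded operator whose form is invariant under all swaps of balls is a scalar. -/
theorem IsSwapInvariant.exists_eq_smul (hX : openHaar X Set.univ = ∞)
    (hA : IsSwapInvariant s q A) (hq : IsIrreducibleFamily (Set.range q)) :
    ∃ a : ℂ, ∀ u, A u = a • u := by
  obtain ⟨r₀, c₀, hc₀⟩ := exists_isBoxCenter hX n
  have := hq.1
  obtain ⟨w₀, hw₀⟩ := exists_ne (0 : W)
  set u₀ := boxVec (openHaar X) s q (Metric.closedBall c₀ r₀) w₀ with hu₀
  have hne : inner ℂ u₀ u₀ ≠ 0 := inner_self_ne_zero.2 (boxVec_ne_zero hc₀ hw₀)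
  choose a ha using hA.exists_inner_boxSpan hX hq
  -- The nonzero vector `u₀` lies in the span for every smaller radius, so evaluating both forms on
  -- it identifies the constants.
  have hconst : ∀ r, 0 < r → r ≤ r₀ → a r = a r₀ := by
    intro r hr h
    have h1 := ha r u₀ (boxVec_mem_boxSpan s q hc₀ hr h w₀) u₀
      (boxVec_mem_boxSpan s q hc₀ hr h w₀)
    have h2 := ha r₀ u₀ (boxVec_mem_boxSpan s q hc₀ hc₀.pos le_rfl w₀) u₀
      (boxVec_mem_boxSpan s q hc₀ hc₀.pos le_rfl w₀)
    exact mul_right_cancel₀ hne (h1.symm.trans h2)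
  have hform : ∀ u ∈ ⨆ r, boxSpan s q r, ∀ v ∈ ⨆ r, boxSpan s q r,
      inner ℂ (A u) v = a r₀ * inner ℂ u v := by
    intro u hu v hv
    obtain ⟨r, hr, hr', hu⟩ := exists_mem_boxSpan hc₀.pos hu
    obtain ⟨t, ht, ht', hv⟩ := exists_mem_boxSpan hc₀.pos hv
    have h0 := lt_min hr ht
    rw [ha (min r t) u (boxSpan_le s q h0 (min_le_left _ _) hu) v
      (boxSpan_le s q h0 (min_le_right _ _) hv), hconst _ h0 ((min_le_left _ _).trans hr')]
  have hdense := iSup_boxSpan_dense s q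
  have hbot := Submodule.topologicalClosure_eq_top_iff.1 hdense
  refine ⟨starRingEnd ℂ (a r₀), ?_⟩
  have heq : Set.EqOn A (fun u => starRingEnd ℂ (a r₀) • u) (⨆ r, boxSpan s q r : Submodule ℂ _) := by
    intro u hu
    rw [← sub_eq_zero, ← Submodule.mem_bot ℂ, ← hbot, Submodule.mem_orthogonal']
    intro v hv
    rw [inner_sub_left, inner_smul_left, hform u hu v hv]
    simp
  exact congrFun (Continuous.ext_on (Submodule.dense_iff_topologicalClosure_eq_top.2 hdense)
    A.continuous (continuous_const_smul _) heq)

end Commutant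

/-! ### Invariant subspaces and the conclusion -/

section Main

variable {K : Type u} [NontriviallyNormedField K] [IsUltrametricDist K] [ProperSpace K]
  [MeasurableSpace K] [BorelSpace K] {d : ℕ}
  {X : TopologicalSpace.Opens (Fin d → K)} {n : ℕ}
  {W : Type w} [NormedAddCommGroup W] [InnerProductSpace ℂ W]
  {s : MeasurableSection X n} {q : Equiv.Perm (Fin n) →* (W ≃ₗᵢ[ℂ] W)}
  {M : Submodule ℂ (Lp W 2 (confMeasure (openHaar X) n))}

/-- Invariance is passed from the swaps, which lie in `diffCMeas t X`, to the group they generate;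
the inverses of generators need no separate argument because swaps are involutions. -/
theorem repV_mem_of_mem_swapGroup {t : ℝ≥0∞}
    (hM : ∀ ψ (hψ : ψ ∈ diffCMeas t X), ∀ v ∈ M,
      repV (openHaar X) s q ⟨ψ, diffCMeas_subset t X n hψ⟩ v ∈ M)
    {r : ℝ} {g : X ≃ₜ X} (hg : g ∈ swapGroup X r) :
    ∀ v ∈ M, repV (openHaar X) s q ⟨g, mem_quasiInvGroup_of_mem_swapGroup hg⟩ v ∈ M := by
  induction hg using Subgroup.closure_induction'' with
  | mem g hg =>
    obtain ⟨a, b, h, rfl⟩ := hg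
    exact hM _ (h.homeo_mem_diffCMeas t)
  | inv_mem g hg =>
    obtain ⟨a, b, h, rfl⟩ := hg
    exact hM _ (h.homeo_mem_diffCMeas t)
  | one =>
    intro v hv
    have : repV (openHaar X) s q 1 v ∈ M := by rwa [map_one]
    exact this
  | mul g g' hg hg' h h' =>
    intro v hv
    have := h _ (h' v hv)
    have hmul := map_mul (repV (openHaar X) s q)
      ⟨g, mem_quasiInvGroup_of_mem_swapGroup hg⟩ ⟨g', mem_quasiInvGroup_of_mem_swapGroup hg'⟩
    exact (congrArg (· v ∈ M) hmul).mpr this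

/-- Since `M` is invariant under each operator and its inverse, so is its orthogonal complement. The
projection thus commutes with these unitary operators. -/
theorem isSwapInvariant_starProjection [M.HasOrthogonalProjection]
    (hM : ∀ (r : ℝ) (g : X ≃ₜ X) (hg : g ∈ swapGroup X r), ∀ v ∈ M,
      repV (openHaar X) s q ⟨g, mem_quasiInvGroup_of_mem_swapGroup hg⟩ v ∈ M) :
    IsSwapInvariant s q M.starProjection := by
  intro r g hg u v
  have hMg := hM r g hg
  have hinv : ∀ w ∈ M,
      (repV (openHaar X) s q ⟨g, mem_quasiInvGroup_of_mem_swapGroup hg⟩).symm w ∈ M := by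
    intro w hw
    have h1 := hM r g⁻¹ (inv_mem hg) w hw
    have h2 := map_inv (repV (openHaar X) s q) ⟨g, mem_quasiInvGroup_of_mem_swapGroup hg⟩
    exact (congrArg (· w ∈ M) h2).mp h1
  generalize repV (openHaar X) s q ⟨g, mem_quasiInvGroup_of_mem_swapGroup hg⟩ = V at hinv hMg ⊢
  have hkey : M.starProjection (V u) = V (M.starProjection u) := by
    refine Submodule.eq_starProjection_of_mem_of_inner_eq_zero
      (hMg _ (M.starProjection_apply_mem u)) fun w hw => ?_
    rw [← map_sub, ← V.apply_symm_apply w, V.inner_map_map]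
    exact Submodule.inner_left_of_mem_orthogonal (hinv w hw)
      (M.sub_starProjection_mem_orthogonal u)
  rw [hkey, V.inner_map_map]

end Main

theorem theorem3p4 {K : Type u} [NontriviallyNormedField K] [IsUltrametricDist K] [ProperSpace K]
    [MeasurableSpace K] [BorelSpace K]
    (d : ℕ) (X : TopologicalSpace.Opens (Fin d → K)) (hX : openHaar X Set.univ = ∞)
    (t : ℝ≥0∞) (ht : 1 ≤ t)
    (n : ℕ) (hn : 1 ≤ n) (s : MeasurableSection X n)
    {W : Type w} [NormedAddCommGroup W] [InnerProductSpace ℂ W] [CompleteSpace W]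
    (q : Equiv.Perm (Fin n) →* (W ≃ₗᵢ[ℂ] W)) (hq : IsIrreducibleFamily (Set.range q)) :
    IsIrreducibleFamily
      (repV (openHaar X) s q '' {ψ : quasiInvGroup (openHaar X) n | ψ.1 ∈ diffCMeas t X}) := by
  have := finiteDimensional_of_isIrreducibleFamily hq
  constructor
  · obtain ⟨r₀, c₀, hc₀⟩ := exists_isBoxCenter hX n
    have := hq.1
    obtain ⟨w₀, hw₀⟩ := exists_ne (0 : W)
    exact ⟨_, 0, boxVec_ne_zero (s := s) (q := q) hc₀ hw₀⟩
  · intro M hMc hM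
    have hM' : ∀ ψ (hψ : ψ ∈ diffCMeas t X), ∀ v ∈ M,
        repV (openHaar X) s q ⟨ψ, diffCMeas_subset t X n hψ⟩ v ∈ M := fun ψ hψ v hv =>
      hM _ ⟨⟨ψ, diffCMeas_subset t X n hψ⟩, hψ, rfl⟩ v hv
    have : CompleteSpace M := hMc.completeSpace_coe
    obtain ⟨a, ha⟩ := (isSwapInvariant_starProjection (M := M) fun r g hg =>
      repV_mem_of_mem_swapGroup hM' hg).exists_eq_smul hX hq
    -- The projection is multiplication by `a`; if it fixes a nonzero vector then `a = 1`, so it is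
    -- the identity.
    refine or_iff_not_imp_left.2 fun hbot => ?_
    obtain ⟨v, hv, hv0⟩ := Submodule.exists_mem_ne_zero_of_ne_bot hbot
    have h1 : a • v = (1 : ℂ) • v := by
      rw [← ha, one_smul]; exact Submodule.starProjection_eq_self_iff.2 hv
    have ha1 : a = 1 := smul_left_injective ℂ hv0 h1
    rw [Submodule.eq_top_iff']
    intro u
    rw [← Submodule.starProjection_eq_self_iff, ha, ha1, one_smul]
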